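/- For a real number $p\ge 1$ and $n\in\mathbb N$ let $B_p^n=\{x\in\mathbb R^n:(\sum_{i=1}^n|x_i|^p)^{1/p}\le 1\}$ be the closed unit ball of $l_p^n$. For $n\ge 2$ and a Euclidean unit vector $a\in\mathbb R^n$ put $$A_{n,p}(a)=\frac{\mathrm{vol}_{n-1}(a^\perp\cap B_p^n)}{\mathrm{vol}_{n-1}(B_p^{n-1})},\qquad a^\perp=\{x\in\mathbb R^n:\langle a,x\rangle=0\},$$ and let $a^{(n)}=\frac1{\sqrt n}(1,\dots,1)$ and $a^{(2)}=\frac1{\sqrt 2}(1,1,0,\dots,0)$ in $\mathbb R^n$. For $p>2$ let $$g(p)=\sqrt{\frac 3\pi}\,\sqrt{\frac{2^{2/p}\,\Gamma(1+\frac1p)^3}{\Gamma(1+\frac3p)}} .$$ **Theorem 1.** There is exactly one $p_0\in(2,\infty)$ with $g(p_0)=1$, and $p_0\simeq 26.265$ (precisely, $|p_0-26.265|\le 0.0005$). For all $2<p<p_0$, $$\lim_{n\to\infty}\frac{A_{n,p}(a^{(n)})}{A_{n,p}(a^{(2)})}=g(p)>1 .$$ Moreover, $A_{n,p}(a^{(n)})>A_{n,p}(a^{(2)})$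 holds whenever (a) $5\le p<p_0$ and $n\ge\frac{650}{p_0-p}$, or (b) $2<p<5$ and $n>\frac{65}{p-2}$. -/

import Mathlib

open Filter Topology MeasureTheory

namespace LpSection

/-- The closed unit ball of `ℓ_p^n` (for `1 ≤ p < ∞`), as a subset of Euclidean `n`-space. -/
def lpBall (n : ℕ) (p : ℝ) : Set (EuclideanSpace ℝ (Fin n)) :=
  {x | (∑ i, |x i| ^ p) ^ (1 / p) ≤ 1}

/-- The hyperplane `a^⊥` through the origin. -/
def hyperplane {n : ℕ} (a : EuclideanSpace ℝ (Fin n)) : Set (EuclideanSpace ℝ (Fin n)) :=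
  {x | inner ℝ a x = 0}

/-- The normalized section function `A_{n,p}(a) = vol_{n-1}(a^⊥ ∩ B_p^n) / vol_{n-1}(B_p^{n-1})`.
The `(n-1)`-dimensional volume of a subset of Euclidean `n`-space is the Euclidean Hausdorff
measure, normalized so that it agrees with Lebesgue measure on Euclidean `(n-1)`-space. -/
noncomputable def sectionFun (n : ℕ) (p : ℝ) (a : EuclideanSpace ℝ (Fin n)) : ℝ :=
  ((μHE[n - 1] : Measure (EuclideanSpace ℝ (Fin n))) (hyperplane a ∩ lpBall n p)).toReal /
    ((volume : Measure (EuclideanSpace ℝ (Fin (n - 1)))) (lpBall (n - 1) p)).toReal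

/-- The main diagonal direction `a^(n) = n^(-1/2) (1, …, 1)`. -/
noncomputable def diagDir (n : ℕ) : EuclideanSpace ℝ (Fin n) :=
  WithLp.toLp 2 fun _ => 1 / √(n : ℝ)

/-- The direction `a^(2) = 2^(-1/2) (1, 1, 0, …, 0)` (for `n ≥ 2`). -/
noncomputable def pairDir (n : ℕ) : EuclideanSpace ℝ (Fin n) :=
  WithLp.toLp 2 fun i => if (i : ℕ) < 2 then 1 / √2 else 0

/-- The limit value `√(3/π) √(2^(2/p) Γ(1+1/p)^3 / Γ(1+3/p))`. -/
noncomputable def limitValue (p : ℝ) : ℝ :=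
  √(3 / Real.pi) *
    √((2 : ℝ) ^ (2 / p) * Real.Gamma (1 + 1 / p) ^ 3 / Real.Gamma (1 + 3 / p))

end LpSection

namespace LpSection

/-! Write f(x) = exp(-|x|^p). For a norm g on a d-dimensional space, the integral of exp(-g^p) is
Γ(1 + d/p) times the volume of the unit ball. A section and the ball B_p^(n-1) have the same
dimension, so the Gamma factors cancel and A_{n,p}(a) becomes a quotient of integrals of products of
f (`sectionFun_eq_integral_div`). For a^(2) it evaluates to 2^(1/2 - 1/p). For a^(n), Fourier
inversion turns it into an integral of the n-th power of the cosine transform of f.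

Let φ be the characteristic function of the probability density proportional to f, with variance v.
The ratio of the two sections is then g(p) · √(v n / 2π) · ∫ φ^n (`sectionFun_ratio`). The second
factor tends to 1 by a local central limit argument, which gives the limit.

For finite n, φ(t) ≥ 1 - v t²/2 gives a Wallis integral as main term. Beyond the zero of that
parabola only negative values of φ can hurt, and there |φ| ≤ 1/π, so the loss is exponentially
small. The second factor, squared, is thus about 1 - 3/(4n) or more, and g(p)² ≥ 1 + 0.9/n suffices
once n ≥ 20.

It remains to study g. As a function of x = 1/p, log g² is a linear function plus 3 log Γ(1+x) - log
Γ(1+3x), which Euler's limit writes as a sum of functions concave on (0, 1/2]. Hence log g² is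
strictly concave there. It vanishes at x = 1/2 (p = 2), so it has at most one other zero, and is
positive between the two. Zeta-value expansions locate that zero, and chords below the concave graph
give the linear lower bounds behind the constants 650 and 65. -/

/-! ### Sections as quotients of exponential integrals -/

/-- Injectivity of `L` makes y ↦ ‖L y‖_p a norm on `E`, so the general volume formula for unit balls
applies. It is used with the identity and with the parametrization of a hyperplane. -/
theorem measureReal_linear_preimage_lpBall {E : Type*} [NormedAddCommGroup E] [NormedSpace ℝ E]
    [FiniteDimensional ℝ E] [Nontrivial E] [MeasurableSpace E] [BorelSpace E] (μ : Measure E)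
    [μ.IsAddHaarMeasure] {k : ℕ} {p : ℝ} (hp : 1 ≤ p)
    (L : E →ₗ[ℝ] EuclideanSpace ℝ (Fin k)) (hL : Function.Injective L) :
    (μ (L ⁻¹' lpBall k p)).toReal =
      (∫ y, Real.exp (-∑ i, |L y i| ^ p) ∂μ) / Real.Gamma (Module.finrank ℝ E / p + 1) := by
  have h₁ : 0 < p := by linarith
  have h₂ : (ENNReal.ofReal p).toReal = p := ENNReal.toReal_ofReal h₁.le
  have : Fact (1 ≤ ENNReal.ofReal p) :=
    fact_iff.mpr (ENNReal.ofReal_one ▸ (ENNReal.ofReal_le_ofReal hp))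
  have eq_norm (x : Fin k → ℝ) :
      ‖WithLp.toLp (.ofReal p) x‖ = (∑ i, |x i| ^ p) ^ (1 / p) := by
    simp [PiLp.norm_eq_sum (f := WithLp.toLp (.ofReal p) x) (h₂.symm ▸ h₁), h₂]
  set g : E → ℝ := fun y => ‖WithLp.toLp (.ofReal p) (L y).ofLp‖ with hg
  have g0 : g 0 = 0 := by simp [hg]
  have gneg : ∀ x, g (-x) = g x := fun x => by simp [hg]
  have gadd : ∀ x y, g (x + y) ≤ g x + g y := fun x y => by
    simpa [hg] using norm_add_le (WithLp.toLp (.ofReal p) (L x).ofLp)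
      (WithLp.toLp (.ofReal p) (L y).ofLp)
  have gz : ∀ {x}, g x = 0 → x = 0 := fun {x} hx => by
    have h := (norm_eq_zero.mp hx)
    have h' : (L x).ofLp = 0 := by simpa using h
    apply hL
    rw [map_zero]
    ext i
    simp [h']
  have gsmul : ∀ r x, g (r • x) ≤ |r| * g x := fun r x => by
    simp only [hg, map_smul, WithLp.ofLp_smul, WithLp.toLp_smul]
    exact norm_smul_le r (WithLp.toLp (.ofReal p) (L x).ofLp)
  have e : L ⁻¹' lpBall k p = {y | g y ≤ 1} := by
    ext y
    simp [lpBall, hg, eq_norm]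
  have hpos : ∀ y, 0 ≤ ∑ i, |L y i| ^ p := fun y =>
    Finset.sum_nonneg fun i _ => Real.rpow_nonneg (abs_nonneg _) _
  rw [e, measure_le_eq_lt μ g0 gneg gadd gz gsmul,
    measure_lt_one_eq_integral_div_gamma μ g0 gneg gadd gz gsmul h₁, ENNReal.toReal_ofReal]
  · congr 2
    ext y
    simp only [hg, eq_norm]
    rw [← Real.rpow_mul (hpos y), one_div_mul_cancel h₁.ne', Real.rpow_one]
  · exact div_nonneg (integral_nonneg fun _ => (Real.exp_pos _).le)
      (Real.Gamma_pos_of_pos (by positivity)).le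

/-- The parametrization of the hyperplane `x₀ + ⟨c, (x₁, …, x_m)⟩ = 0` by its last coordinates. -/
noncomputable def hyperplaneParam {m : ℕ} (c : EuclideanSpace ℝ (Fin m)) :
    EuclideanSpace ℝ (Fin m) →ₗ[ℝ] EuclideanSpace ℝ (Fin (m + 1)) where
  toFun y := WithLp.toLp 2 (Fin.cons (-inner ℝ c y) y.ofLp)
  map_add' x y := by
    ext i
    refine Fin.cases ?_ (fun j => ?_) i
    · simp [inner_add_right]; ring
    · simp
  map_smul' r y := by
    ext i
    refine Fin.cases ?_ (fun j => ?_) i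
    · simp [inner_smul_right]
    · simp

theorem hyperplaneParam_zero {m : ℕ} (c y : EuclideanSpace ℝ (Fin m)) :
    hyperplaneParam c y 0 = -inner ℝ c y := rfl

theorem hyperplaneParam_succ {m : ℕ} (c y : EuclideanSpace ℝ (Fin m)) (j : Fin m) :
    hyperplaneParam c y j.succ = y j := rfl

theorem hyperplaneParam_injective {m : ℕ} (c : EuclideanSpace ℝ (Fin m)) :
    Function.Injective (hyperplaneParam c) := by
  intro x y h
  ext j
  rw [← hyperplaneParam_succ c x, ← hyperplaneParam_succ c y, h]

/-- The Gram matrix of the graph parametrization is the identity plus the rank-one matrix c cᵀ, so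
the matrix determinant lemma applies. This is the area factor of the section. -/
theorem normDet_hyperplaneParam {m : ℕ} (c : EuclideanSpace ℝ (Fin m)) :
    (hyperplaneParam c).normDet = √(1 + ∑ j, c j ^ 2) := by
  rw [← Real.sqrt_sq (LinearMap.normDet_nonneg _)]
  congr 1
  have h := LinearMap.normDet_sq_eq_det_gram (hyperplaneParam c)
    (EuclideanSpace.basisFun (Fin m) ℝ)
  have e : (Matrix.gram ℝ fun j => hyperplaneParam c (EuclideanSpace.basisFun (Fin m) ℝ j)) =
      1 + Matrix.replicateCol Unit c.ofLp * Matrix.replicateRow Unit c.ofLp := by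
    ext i j
    simp only [Matrix.gram_apply, PiLp.inner_apply (𝕜 := ℝ), Fin.sum_univ_succ,
      hyperplaneParam_zero, hyperplaneParam_succ]
    simp [Matrix.mul_apply, Matrix.one_apply]
    ring
  rw [e, Matrix.det_one_add_replicateCol_mul_replicateRow] at h
  simpa [dotProduct, sq] using h

theorem hyperplane_inter_lpBall_eq_image {m : ℕ} (p : ℝ) (c : EuclideanSpace ℝ (Fin m))
    (a : EuclideanSpace ℝ (Fin (m + 1))) (h0 : a 0 ≠ 0) (ha : ∀ j : Fin m, a j.succ = a 0 * c j) :
    hyperplane a ∩ lpBall (m + 1) p =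
      hyperplaneParam c '' (hyperplaneParam c ⁻¹' lpBall (m + 1) p) := by
  rw [Set.image_preimage_eq_inter_range, Set.inter_comm]
  congr 1
  have key : ∀ x : EuclideanSpace ℝ (Fin (m + 1)),
      inner ℝ a x = a 0 * (x 0 + ∑ j, c j * x j.succ) := by
    intro x
    simp only [PiLp.inner_apply (𝕜 := ℝ), Fin.sum_univ_succ, ha, RCLike.inner_apply, conj_trivial,
      mul_add, Finset.mul_sum]
    congr 1
    · ring
    · exact Finset.sum_congr rfl fun j _ => by ring
  have key2 : ∀ y : EuclideanSpace ℝ (Fin m), inner ℝ c y = ∑ j, c j * y j := by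
    intro y
    simp only [PiLp.inner_apply (𝕜 := ℝ), RCLike.inner_apply, conj_trivial]
    exact Finset.sum_congr rfl fun j _ => by ring
  ext x
  simp only [hyperplane, Set.mem_ofPred_eq, Set.mem_range]
  constructor
  · intro hx
    rw [key, mul_eq_zero, or_iff_right h0] at hx
    refine ⟨WithLp.toLp 2 fun j => x j.succ, ?_⟩
    ext i
    refine Fin.cases ?_ (fun j => ?_) i
    · rw [hyperplaneParam_zero, key2]
      simp only
      linarith
    · rw [hyperplaneParam_succ]
  · rintro ⟨y, rfl⟩
    rw [key]
    simp only [hyperplaneParam_zero, hyperplaneParam_succ, key2]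
    simp

/-- The volume of a central section of `B_p` as a quotient of exponential integrals. -/
theorem sectionFun_eq_integral_div {m : ℕ} (hm : m ≠ 0) {p : ℝ} (hp : 1 ≤ p)
    (c : Fin m → ℝ) (a : EuclideanSpace ℝ (Fin (m + 1))) (h0 : a 0 ≠ 0)
    (ha : ∀ j : Fin m, a j.succ = a 0 * c j) :
    sectionFun (m + 1) p a = √(1 + ∑ j, c j ^ 2) *
      (∫ y : Fin m → ℝ, Real.exp (-|∑ j, c j * y j| ^ p) * ∏ j, Real.exp (-|y j| ^ p)) /
        (∫ x : ℝ, Real.exp (-|x| ^ p)) ^ m := by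
  have hm' : Nontrivial (EuclideanSpace ℝ (Fin m)) := by
    have : Nonempty (Fin m) := ⟨⟨0, Nat.pos_of_ne_zero hm⟩⟩
    infer_instance
  have hfr : Module.finrank ℝ (EuclideanSpace ℝ (Fin m)) = m := by simp
  set c' : EuclideanSpace ℝ (Fin m) := WithLp.toLp 2 c with hc'
  have himg := (hyperplaneParam c').euclideanHausdorffMeasure_image
    (hyperplaneParam c' ⁻¹' lpBall (m + 1) p)
  rw [hfr, EuclideanSpace.euclideanHausdorffMeasure_eq_volume,
    ← hyperplane_inter_lpBall_eq_image p c' a h0 ha] at himg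
  have hden := measureReal_linear_preimage_lpBall
    (volume : Measure (EuclideanSpace ℝ (Fin m))) hp LinearMap.id (fun _ _ h => h)
  have hnum := measureReal_linear_preimage_lpBall
    (volume : Measure (EuclideanSpace ℝ (Fin m))) hp (hyperplaneParam c')
      (hyperplaneParam_injective c')
  simp only [LinearMap.id_coe, Set.preimage_id, id] at hden
  -- Both bodies are parametrized by the same m-dimensional space, so this factor occurs in
  -- numerator and denominator and cancels.
  have hG : Real.Gamma (Module.finrank ℝ (EuclideanSpace ℝ (Fin m)) / p + 1) ≠ 0 :=
    (Real.Gamma_pos_of_pos (by positivity)).ne'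
  have tr : ∀ f : (Fin m → ℝ) → ℝ,
      ∫ y : EuclideanSpace ℝ (Fin m), f y.ofLp = ∫ y, f y := fun f =>
    (EuclideanSpace.volume_preserving_symm_measurableEquiv_toLp (Fin m)).integral_comp' f
  have hdef : sectionFun (m + 1) p a = (μHE[m] (hyperplane a ∩ lpBall (m + 1) p)).toReal /
      ((volume : Measure (EuclideanSpace ℝ (Fin m))) (lpBall m p)).toReal := rfl
  rw [hdef, himg, ENNReal.toReal_mul,
    ENNReal.toReal_ofReal (LinearMap.normDet_nonneg _), normDet_hyperplaneParam, hnum, hden,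
    mul_div_assoc, div_div_div_cancel_right₀ hG, mul_div_assoc]
  congr 2
  · rw [← tr]
    congr 1
    ext y
    rw [Fin.sum_univ_succ, neg_add, Real.exp_add, ← Finset.sum_neg_distrib, Real.exp_sum]
    simp only [hyperplaneParam_zero, hyperplaneParam_succ, abs_neg, PiLp.inner_apply (𝕜 := ℝ),
      RCLike.inner_apply, conj_trivial, hc', mul_comm]
  · rw [tr fun y => Real.exp (-∑ i, |y i| ^ p)]
    simp_rw [← Finset.sum_neg_distrib, Real.exp_sum]
    rw [integral_fintype_prod_volume_eq_pow (fun x : ℝ => Real.exp (-|x| ^ p)), Fintype.card_fin]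

/-! ### The density exp(-|x|^p): moments and derivatives -/

/-- The (unnormalized) density `exp (-|x|^p)`. -/
noncomputable def expNegPow (p x : ℝ) : ℝ := Real.exp (-|x| ^ p)

/-- The cosine transform of `expNegPow p`. -/
noncomputable def cosTransform (p t : ℝ) : ℝ := ∫ x, Real.cos (t * x) * expNegPow p x

theorem expNegPow_pos (p x : ℝ) : 0 < expNegPow p x := Real.exp_pos _

theorem expNegPow_neg (p x : ℝ) : expNegPow p (-x) = expNegPow p x := by simp [expNegPow]

theorem integrable_comp_abs_of_integrableOn_Ioi {f : ℝ → ℝ} (hf : IntegrableOn f (Set.Ioi 0)) :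
    Integrable fun x => f |x| := by
  have h1 : IntegrableOn (fun x => f |x|) (Set.Ioi 0) :=
    hf.congr_fun (fun x hx => by simp only [abs_of_pos (Set.mem_Ioi.mp hx)]) measurableSet_Ioi
  have h2 : IntegrableOn (fun x => f |x|) (Set.Iic 0) := by
    rw [← Measure.map_neg_eq_self (volume : Measure ℝ)]
    have m : MeasurableEmbedding fun x : ℝ => -x := (Homeomorph.neg ℝ).measurableEmbedding
    rw [m.integrableOn_map_iff]
    simp_rw [Function.comp_def, abs_neg, Set.neg_preimage, Set.neg_Iic, neg_zero]
    exact Iff.mpr integrableOn_Ici_iff_integrableOn_Ioi h1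
  rw [← integrableOn_univ, ← Set.Iic_union_Ioi (a := (0 : ℝ))]
  exact h2.union h1

theorem integrable_abs_rpow_mul_expNegPow {p s : ℝ} (hp : 0 < p) (hs : -1 < s) :
    Integrable fun x => |x| ^ s * expNegPow p x :=
  integrable_comp_abs_of_integrableOn_Ioi (integrableOn_rpow_mul_exp_neg_rpow hs hp)

theorem integrable_expNegPow {p : ℝ} (hp : 0 < p) : Integrable (expNegPow p) := by
  simpa using integrable_abs_rpow_mul_expNegPow hp (s := 0) (by norm_num)

theorem integral_abs_rpow_mul_expNegPow {p s : ℝ} (hp : 0 < p) (hs : -1 < s) :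
    ∫ x, |x| ^ s * expNegPow p x = 2 * ((1 / p) * Real.Gamma ((s + 1) / p)) := by
  rw [← integral_rpow_mul_exp_neg_rpow hp hs, ← integral_comp_abs]
  rfl

theorem integral_expNegPow {p : ℝ} (hp : 0 < p) :
    ∫ x, expNegPow p x = 2 * Real.Gamma (1 + 1 / p) := by
  have h := integral_abs_rpow_mul_expNegPow hp (s := 0) (by norm_num)
  simp only [Real.rpow_zero, one_mul, zero_add] at h
  rw [h, add_comm 1, Real.Gamma_add_one (by positivity)]

theorem integral_expNegPow_pos {p : ℝ} (hp : 0 < p) : 0 < ∫ x, expNegPow p x := by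
  rw [integral_expNegPow hp]
  have := Real.Gamma_pos_of_pos (show 0 < 1 + 1 / p by positivity)
  positivity

theorem integral_sq_mul_expNegPow {p : ℝ} (hp : 0 < p) :
    ∫ x, x ^ 2 * expNegPow p x = 2 * Real.Gamma (1 + 3 / p) / 3 := by
  have h := integral_abs_rpow_mul_expNegPow hp (s := 2) (by norm_num)
  have e : ∀ x : ℝ, |x| ^ (2 : ℝ) = x ^ 2 := fun x => by
    rw [Real.rpow_two, sq_abs]
  simp only [e] at h
  rw [h, add_comm 1, Real.Gamma_add_one (by positivity)]
  norm_num
  field_simp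

theorem integrable_sq_mul_expNegPow {p : ℝ} (hp : 0 < p) :
    Integrable fun x => x ^ 2 * expNegPow p x := by
  have h := integrable_abs_rpow_mul_expNegPow hp (s := 2) (by norm_num)
  have e : ∀ x : ℝ, |x| ^ (2 : ℝ) = x ^ 2 := fun x => by
    rw [Real.rpow_two, sq_abs]
  simpa only [e] using h

theorem continuous_expNegPow {p : ℝ} (hp : 0 < p) : Continuous (expNegPow p) := by
  unfold expNegPow
  exact Real.continuous_exp.comp (continuous_abs.rpow_const fun _ => Or.inr hp.le).neg

theorem hasDerivAt_expNegPow {p : ℝ} (hp : 1 < p) (x : ℝ) :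
    HasDerivAt (expNegPow p) (-(p * |x| ^ (p - 2) * x * expNegPow p x)) x := by
  refine HasDerivAt.congr_deriv (hasDerivAt_abs_rpow x hp).neg.exp ?_
  simp only [expNegPow, Pi.neg_apply]
  ring

theorem hasDerivAt_abs_rpow_mul_self {q : ℝ} (hq : 0 < q) (x : ℝ) :
    HasDerivAt (fun x : ℝ => |x| ^ q * x) ((q + 1) * |x| ^ q) x := by
  rcases eq_or_ne x 0 with rfl | hx
  · simp only [abs_zero, Real.zero_rpow hq.ne', mul_zero]
    rw [hasDerivAt_iff_tendsto_slope]
    have : Tendsto (fun y : ℝ => |y| ^ q) (𝓝[≠] 0) (𝓝 0) := by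
      have h : Continuous fun y : ℝ => |y| ^ q := continuous_abs.rpow_const fun _ => Or.inr hq.le
      simpa [Real.zero_rpow hq.ne'] using (h.tendsto 0).mono_left nhdsWithin_le_nhds
    refine this.congr' ?_
    filter_upwards [self_mem_nhdsWithin] with y hy
    have hy' : y ≠ 0 := hy
    rw [slope_def_field]
    field_simp
    simp [Real.zero_rpow hq.ne']
  · have h1 : HasDerivAt (fun x : ℝ => |x| ^ q) (SignType.sign x * q * |x| ^ (q - 1)) x :=
      (hasDerivAt_abs hx).rpow_const (Or.inl (abs_ne_zero.mpr hx))
    refine (h1.mul (hasDerivAt_id x)).congr_deriv ?_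
    have h2 : |x| ^ q = |x| ^ (q - 1) * |x| := by
      rw [Real.rpow_sub_one (abs_ne_zero.mpr hx)]
      field_simp
    have h3 : (SignType.sign x : ℝ) * x = |x| := sign_mul_self x
    simp only [id, mul_one]
    calc (SignType.sign x : ℝ) * q * |x| ^ (q - 1) * x + |x| ^ q
        = q * |x| ^ (q - 1) * ((SignType.sign x : ℝ) * x) + |x| ^ q := by ring
      _ = (q + 1) * |x| ^ q := by rw [h3, h2]; ring

/-- Minus the derivative of `expNegPow p`. -/
noncomputable def slopeFun (p x : ℝ) : ℝ := p * (|x| ^ (p - 2) * x) * expNegPow p x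

/-- The derivative of `slopeFun p`. -/
noncomputable def slopeDeriv (p x : ℝ) : ℝ :=
  p * (p - 1) * (|x| ^ (p - 2) * expNegPow p x) - p ^ 2 * (|x| ^ (2 * p - 2) * expNegPow p x)

theorem hasDerivAt_expNegPow' {p : ℝ} (hp : 1 < p) (x : ℝ) :
    HasDerivAt (expNegPow p) (-slopeFun p x) x :=
  (hasDerivAt_expNegPow hp x).congr_deriv (by simp only [slopeFun]; ring)

/-- For p > 2 the factor |x|^(p-2) x is differentiable even at the origin, which permits a second
integration by parts. -/
theorem hasDerivAt_slopeFun {p : ℝ} (hp : 2 < p) (x : ℝ) :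
    HasDerivAt (slopeFun p) (slopeDeriv p x) x := by
  have h1 := ((hasDerivAt_abs_rpow_mul_self (sub_pos.mpr hp) x).const_mul p).mul
    (hasDerivAt_expNegPow (by linarith) x)
  refine h1.congr_deriv ?_
  have e : |x| ^ (2 * p - 2) = |x| ^ (p - 2) * x * (|x| ^ (p - 2) * x) := by
    rcases eq_or_ne x 0 with rfl | hx
    · rw [abs_zero, Real.zero_rpow (by linarith)]; simp
    · have hx' := abs_pos.mpr hx
      rw [show 2 * p - 2 = (p - 2) + (p - 2) + 2 by ring, Real.rpow_add hx', Real.rpow_add hx',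
        Real.rpow_two, sq_abs]
      ring
  simp only [slopeDeriv, e]
  ring

theorem integrable_slopeFun {p : ℝ} (hp : 1 < p) : Integrable (slopeFun p) := by
  have h := (integrable_abs_rpow_mul_expNegPow (p := p) (s := p - 1) (by linarith)
    (by linarith)).const_mul p
  refine h.mono' ?_ (Eventually.of_forall fun x => ?_)
  · unfold slopeFun
    have := (continuous_expNegPow (p := p) (by linarith)).measurable
    exact (by fun_prop : Measurable _).aestronglyMeasurable
  · rcases eq_or_ne x 0 with rfl | hx
    · simp only [slopeFun, mul_zero, zero_mul, norm_zero]
      have := expNegPow_pos p 0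
      have h0 : (0 : ℝ) ≤ |0| ^ (p - 1) := Real.rpow_nonneg (abs_nonneg _) _
      have : 0 ≤ p := by linarith
      positivity
    · have hx' := abs_pos.mpr hx
      have e : |x| ^ (p - 1) = |x| ^ (p - 2) * |x| := by
        rw [show p - 1 = (p - 2) + 1 by ring, Real.rpow_add hx', Real.rpow_one]
      rw [e, slopeFun, Real.norm_eq_abs, abs_mul, abs_mul, abs_mul,
        abs_of_pos (expNegPow_pos p x), abs_of_pos (by linarith : 0 < p),
        abs_of_nonneg (Real.rpow_nonneg (abs_nonneg x) _)]
      exact le_of_eq (by ring)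

theorem integrable_slopeDeriv {p : ℝ} (hp : 2 < p) : Integrable (slopeDeriv p) :=
  ((integrable_abs_rpow_mul_expNegPow (p := p) (s := p - 2) (by linarith)
    (by linarith)).const_mul _).sub
  ((integrable_abs_rpow_mul_expNegPow (p := p) (s := 2 * p - 2) (by linarith)
    (by linarith)).const_mul _)

theorem Integrable.bdd_mul_cos {f : ℝ → ℝ} (hf : Integrable f) (t : ℝ) :
    Integrable fun x => Real.cos (t * x) * f x :=
  hf.bdd_mul (c := 1) (by fun_prop) (Eventually.of_forall fun x => Real.abs_cos_le_one _)

theorem Integrable.bdd_mul_sin {f : ℝ → ℝ} (hf : Integrable f) (t : ℝ) :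
    Integrable fun x => Real.sin (t * x) * f x :=
  hf.bdd_mul (c := 1) (by fun_prop) (Eventually.of_forall fun x => Real.abs_sin_le_one _)

/-! ### Decay of the cosine transform and Fourier inversion -/

theorem mul_cosTransform {p : ℝ} (hp : 1 < p) (t : ℝ) :
    t * cosTransform p t = ∫ x, Real.sin (t * x) * slopeFun p x := by
  have hi := integrable_expNegPow (p := p) (by linarith)
  have h := integral_mul_deriv_eq_deriv_mul_of_integrable (u := fun x => Real.sin (t * x))
    (v := expNegPow p) (u' := fun x => Real.cos (t * x) * t) (v' := fun x => -slopeFun p x)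
    (fun x _ => ((hasDerivAt_id x).const_mul t).sin.congr_deriv (by simp))
    (fun x _ => hasDerivAt_expNegPow' hp x)
    (Integrable.bdd_mul_sin (integrable_slopeFun hp).neg t)
    (by
      have := (Integrable.bdd_mul_cos hi t).const_mul t
      refine this.congr (Eventually.of_forall fun x => ?_)
      simp only [Pi.mul_apply]; ring)
    (Integrable.bdd_mul_sin hi t)
  simp only [mul_neg, integral_neg, neg_inj] at h
  rw [h, cosTransform, ← integral_const_mul]
  congr 1; ext x; ring

theorem sq_mul_cosTransform {p : ℝ} (hp : 2 < p) (t : ℝ) :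
    t ^ 2 * cosTransform p t = ∫ x, Real.cos (t * x) * slopeDeriv p x := by
  have hi := integrable_slopeFun (p := p) (by linarith)
  have h := integral_mul_deriv_eq_deriv_mul_of_integrable (u := fun x => Real.cos (t * x))
    (v := slopeFun p) (u' := fun x => -Real.sin (t * x) * t) (v' := slopeDeriv p)
    (fun x _ => ((hasDerivAt_id x).const_mul t).cos.congr_deriv (by simp))
    (fun x _ => hasDerivAt_slopeFun hp x)
    (Integrable.bdd_mul_cos (integrable_slopeDeriv hp) t)
    (by
      have := (Integrable.bdd_mul_sin hi t).const_mul (-t)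
      refine this.congr (Eventually.of_forall fun x => ?_)
      simp only [Pi.mul_apply]; ring)
    (Integrable.bdd_mul_cos hi t)
  rw [h, sq, mul_assoc, mul_cosTransform (by linarith), ← integral_const_mul, ← integral_neg]
  congr 1; ext x; ring

theorem continuous_cosTransform {p : ℝ} (hp : 0 < p) : Continuous (cosTransform p) := by
  refine continuous_of_dominated (bound := expNegPow p)
    (fun t => (Integrable.bdd_mul_cos (integrable_expNegPow hp) t).aestronglyMeasurable)
    (fun t => Eventually.of_forall fun x => ?_) (integrable_expNegPow hp)
    (Eventually.of_forall fun x => by fun_prop)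
  rw [norm_mul, Real.norm_of_nonneg (expNegPow_pos p x).le]
  exact mul_le_of_le_one_left (expNegPow_pos p x).le (Real.abs_cos_le_one _)

theorem cosTransform_neg (p t : ℝ) : cosTransform p (-t) = cosTransform p t := by
  simp [cosTransform]

theorem cosTransform_zero (p : ℝ) : cosTransform p 0 = ∫ x, expNegPow p x := by
  simp [cosTransform]

theorem abs_integral_cos_mul_le {f : ℝ → ℝ} (hf : Integrable f) (t : ℝ) :
    |∫ x, Real.cos (t * x) * f x| ≤ ∫ x, |f x| :=
  (norm_integral_le_integral_norm _).trans
    (integral_mono (Integrable.bdd_mul_cos hf t).norm hf.abs fun x => by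
      rw [norm_mul]
      exact mul_le_of_le_one_left (abs_nonneg _) (Real.abs_cos_le_one _))

theorem abs_integral_sin_mul_le {f : ℝ → ℝ} (hf : Integrable f) (t : ℝ) :
    |∫ x, Real.sin (t * x) * f x| ≤ ∫ x, |f x| :=
  (norm_integral_le_integral_norm _).trans
    (integral_mono (Integrable.bdd_mul_sin hf t).norm hf.abs fun x => by
      rw [norm_mul]
      exact mul_le_of_le_one_left (abs_nonneg _) (Real.abs_sin_le_one _))

theorem abs_cosTransform_le {p : ℝ} (hp : 0 < p) (t : ℝ) :
    |cosTransform p t| ≤ ∫ x, expNegPow p x := by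
  simpa only [abs_of_pos (expNegPow_pos p _), cosTransform] using
    abs_integral_cos_mul_le (integrable_expNegPow hp) t

/-- Two integrations by parts bound t² times the transform, and the transform itself is bounded;
together they give a majorant C/(1 + t²). -/
theorem integrable_cosTransform {p : ℝ} (hp : 2 < p) : Integrable (cosTransform p) := by
  have hp0 : 0 < p := by linarith
  refine (integrable_inv_one_add_sq.const_mul
    ((∫ x, expNegPow p x) + ∫ x, |slopeDeriv p x|)).mono'
    (continuous_cosTransform hp0).aestronglyMeasurable (Eventually.of_forall fun t => ?_)
  have h1 := abs_cosTransform_le hp0 t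
  have h2 := abs_integral_cos_mul_le (integrable_slopeDeriv hp) t
  rw [← sq_mul_cosTransform hp, abs_mul, abs_of_nonneg (sq_nonneg t)] at h2
  rw [← div_eq_mul_inv, le_div_iff₀ (by positivity), Real.norm_eq_abs]
  linarith

theorem integrable_cosTransform_pow {p : ℝ} (hp : 2 < p) (n : ℕ) :
    Integrable fun t => cosTransform p t ^ (n + 1) := by
  have hp0 : 0 < p := by linarith
  refine ((integrable_cosTransform hp).bdd_mul (c := (∫ x, expNegPow p x) ^ n)
    (f := fun t => cosTransform p t ^ n)
    ((continuous_cosTransform hp0).pow n).aestronglyMeasurable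
    (Eventually.of_forall fun t => ?_)).congr (Eventually.of_forall fun t => (pow_succ _ _).symm)
  rw [norm_pow]
  exact pow_le_pow_left₀ (norm_nonneg _) (abs_cosTransform_le hp0 t) n

theorem integral_exp_mul_I_mul_expNegPow {p : ℝ} (hp : 0 < p) (t : ℝ) :
    ∫ x : ℝ, Complex.exp (↑(t * x) * Complex.I) * (expNegPow p x : ℂ) = cosTransform p t := by
  have hi := integrable_expNegPow hp
  have hs : ∫ x, Real.sin (t * x) * expNegPow p x = 0 := by
    have h := integral_neg_eq_self (fun x => Real.sin (t * x) * expNegPow p x) volume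
    simp only [mul_neg, Real.sin_neg, expNegPow_neg, neg_mul, integral_neg] at h
    linarith
  have e : ∀ x : ℝ, Complex.exp (↑(t * x) * Complex.I) * (expNegPow p x : ℂ) =
      ((Real.cos (t * x) * expNegPow p x : ℝ) : ℂ) +
        ((Real.sin (t * x) * expNegPow p x : ℝ) : ℂ) * Complex.I := by
    intro x
    rw [Complex.exp_mul_I]
    push_cast
    ring
  simp_rw [e]
  rw [integral_add (Integrable.bdd_mul_cos hi t).ofReal
    ((Integrable.bdd_mul_sin hi t).ofReal.mul_const _), integral_mul_const, integral_complex_ofReal,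
    integral_complex_ofReal, hs, cosTransform]
  simp

theorem integral_cosTransform_mul_exp {p : ℝ} (hp : 2 < p) (s : ℝ) :
    ∫ w : ℝ, Complex.exp (↑(2 * Real.pi * w * s) * Complex.I) *
      (cosTransform p (2 * Real.pi * w) : ℂ) = expNegPow p s := by
  have hp0 : 0 < p := by linarith
  have hF : FourierTransform.fourier (fun x => (expNegPow p x : ℂ)) =
      fun w => (cosTransform p (2 * Real.pi * w) : ℂ) := by
    ext w
    rw [Real.fourier_real_eq_integral_exp_smul, ← cosTransform_neg,
      ← integral_exp_mul_I_mul_expNegPow hp0]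
    congr 1; ext x
    rw [smul_eq_mul]
    congr 4; ring
  have hc : Continuous fun x => (expNegPow p x : ℂ) :=
    Complex.continuous_ofReal.comp (continuous_expNegPow hp0)
  have h := hc.fourierInv_fourier_eq (integrable_expNegPow hp0).ofReal (by
    rw [hF]
    exact ((integrable_cosTransform hp).comp_mul_left' (by positivity)).ofReal)
  have h2 := congrFun h s
  rw [hF, Real.fourierInv_eq'] at h2
  rw [← h2]
  congr 1; ext x
  rw [smul_eq_mul]
  congr 4
  simp only [RCLike.inner_apply, conj_trivial]
  ring

/-- The central section integral of the product density as an integral of powers of the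
cosine transform. -/
theorem integral_expNegPow_sum_mul_prod {p : ℝ} (hp : 2 < p) (m : ℕ) :
    ∫ y : Fin m → ℝ, expNegPow p (∑ j, y j) * ∏ j, expNegPow p (y j) =
      (2 * Real.pi)⁻¹ * ∫ t, cosTransform p t ^ (m + 1) := by
  have hp0 : 0 < p := by linarith
  have hπ := Real.pi_pos
  have hsc := Measure.integral_comp_mul_left (fun t => cosTransform p t ^ (m + 1)) (2 * Real.pi)
  rw [abs_of_pos (by positivity), smul_eq_mul] at hsc
  rw [← hsc]
  apply Complex.ofReal_injective
  rw [← integral_complex_ofReal, ← integral_complex_ofReal]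
  have hprod : Integrable fun y : Fin m → ℝ => ((∏ j, expNegPow p (y j) : ℝ) : ℂ) :=
    (Integrable.fintype_prod (f := fun _ => expNegPow p)
      fun _ => integrable_expNegPow hp0).ofReal
  have hcos : Integrable fun w : ℝ => (cosTransform p (2 * Real.pi * w) : ℂ) :=
    ((integrable_cosTransform hp).comp_mul_left' (by positivity)).ofReal
  -- Only the factor at the sum is expanded by Fourier inversion. After Fubini the character
  -- factorizes over the coordinates: m transforms come from the product, one from the inversion.
  calc ∫ y : Fin m → ℝ, ((expNegPow p (∑ j, y j) * ∏ j, expNegPow p (y j) : ℝ) : ℂ)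
      = ∫ y : Fin m → ℝ, ∫ w : ℝ, Complex.exp (↑(2 * Real.pi * w * ∑ j, y j) * Complex.I) *
          (((∏ j, expNegPow p (y j) : ℝ) : ℂ) * (cosTransform p (2 * Real.pi * w) : ℂ)) := by
        congr 1; ext y
        rw [Complex.ofReal_mul, ← integral_cosTransform_mul_exp hp, ← integral_mul_const]
        congr 1; ext w; ring
    _ = ∫ w : ℝ, ∫ y : Fin m → ℝ, Complex.exp (↑(2 * Real.pi * w * ∑ j, y j) * Complex.I) *
          (((∏ j, expNegPow p (y j) : ℝ) : ℂ) * (cosTransform p (2 * Real.pi * w) : ℂ)) := by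
        apply integral_integral_swap
        refine (hprod.mul_prod hcos).bdd_mul (c := 1) ?_ (Eventually.of_forall fun z => ?_)
        · apply Continuous.aestronglyMeasurable
          fun_prop
        · exact (Complex.norm_exp_ofReal_mul_I _).le
    _ = ∫ w : ℝ, ((cosTransform p (2 * Real.pi * w) ^ (m + 1) : ℝ) : ℂ) := by
        congr 1; ext w
        have e : ∀ y : Fin m → ℝ, Complex.exp (↑(2 * Real.pi * w * ∑ j, y j) * Complex.I) *
            (((∏ j, expNegPow p (y j) : ℝ) : ℂ) * (cosTransform p (2 * Real.pi * w) : ℂ)) =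
            (∏ j, (fun x : ℝ => Complex.exp (↑(2 * Real.pi * w * x) * Complex.I) *
              (expNegPow p x : ℂ)) (y j)) * (cosTransform p (2 * Real.pi * w) : ℂ) := by
          intro y
          rw [Finset.prod_mul_distrib, ← Complex.exp_sum, Finset.mul_sum]
          push_cast
          rw [Finset.sum_mul]
          ring
        simp_rw [e]
        rw [integral_mul_const, integral_fintype_prod_volume_eq_pow
          (fun x : ℝ => Complex.exp (↑(2 * Real.pi * w * x) * Complex.I) * (expNegPow p x : ℂ)),
          integral_exp_mul_I_mul_expNegPow hp0, Fintype.card_fin]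
        push_cast
        ring

/-! ### The two directions -/

theorem sectionFun_diagDir {p : ℝ} (hp : 2 < p) {m : ℕ} (hm : m ≠ 0) :
    sectionFun (m + 1) p (diagDir (m + 1)) = √((m + 1 : ℕ) : ℝ) *
      ((2 * Real.pi)⁻¹ * ∫ t, cosTransform p t ^ (m + 1)) / (∫ x, expNegPow p x) ^ m := by
  rw [sectionFun_eq_integral_div hm (by linarith) (fun _ => 1) (diagDir (m + 1))
    (by simp [diagDir]; positivity) (by simp [diagDir]), ← integral_expNegPow_sum_mul_prod hp]
  simp only [one_mul]
  congr 3
  simp [add_comm]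

theorem sectionFun_pairDir {p : ℝ} (hp : 2 < p) {m : ℕ} (hm : m ≠ 0) :
    sectionFun (m + 1) p (pairDir (m + 1)) = √2 * (2 : ℝ) ^ (-(1 / p)) := by
  have hp0 : 0 < p := by linarith
  obtain ⟨k, rfl⟩ := Nat.exists_eq_succ_of_ne_zero hm
  have hK := integral_expNegPow_pos hp0
  rw [sectionFun_eq_integral_div hm (by linarith) (fun j => if j = 0 then 1 else 0)
    (pairDir (k + 1 + 1)) (by simp [pairDir]) (fun j => by
      rcases eq_or_ne j 0 with rfl | hj
      · simp [pairDir]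
      · have : (j : ℕ) ≠ 0 := fun h => hj (Fin.ext h)
        simp [pairDir, hj, this])]
  have h1 : ∫ y : Fin (k + 1) → ℝ, Real.exp (-|∑ j, (if j = 0 then (1 : ℝ) else 0) * y j| ^ p) *
      ∏ j, Real.exp (-|y j| ^ p) =
      (∫ x, expNegPow p x * expNegPow p x) * (∫ x, expNegPow p x) ^ k := by
    have e := integral_fintype_prod_volume_eq_prod (ι := Fin (k + 1)) (E := fun _ => ℝ)
      (f := fun j x => (if j = 0 then expNegPow p x else 1) * expNegPow p x)
    rw [Fin.prod_univ_succ] at e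
    simp only [if_true, Fin.succ_ne_zero, if_false, one_mul, Finset.prod_const,
      Finset.card_univ, Fintype.card_fin] at e
    rw [← e]
    congr 1; ext y
    simp [Fin.prod_univ_succ, expNegPow, mul_assoc]
  -- The squared density is exp(-2|x|^p), a rescaling of the density by the factor 2^(-1/p).
  have h2 : ∫ x, expNegPow p x * expNegPow p x =
      (2 : ℝ) ^ (-(1 / p)) * ∫ x, expNegPow p x := by
    have e1 : ∫ x, expNegPow p x * expNegPow p x =
        2 * ∫ x in Set.Ioi (0 : ℝ), Real.exp (-2 * x ^ p) := by
      rw [← integral_comp_abs (f := fun x => Real.exp (-2 * x ^ p))]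
      congr 1; ext x
      rw [expNegPow, ← Real.exp_add]
      congr 1; ring
    have e2 : ∫ x, expNegPow p x = 2 * ∫ x in Set.Ioi (0 : ℝ), Real.exp (-x ^ p) := by
      rw [← integral_comp_abs (f := fun x => Real.exp (-x ^ p))]
      rfl
    rw [e1, e2, integral_exp_neg_mul_rpow hp0 (by norm_num), integral_exp_neg_rpow hp0, neg_div]
    ring
  have h3 : 1 + ∑ j : Fin (k + 1), (if j = 0 then (1 : ℝ) else 0) ^ 2 = 2 := by
    simp
    norm_num
  have h4 : ∫ x : ℝ, Real.exp (-|x| ^ p) = ∫ x, expNegPow p x := rfl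
  rw [h1, h2, h3, h4]
  field_simp
  rw [Nat.succ_eq_add_one, pow_succ']

/-! ### The characteristic function of the normalized density -/

/-- The total mass of `expNegPow p`. -/
noncomputable def mass (p : ℝ) : ℝ := ∫ x, expNegPow p x

/-- The variance of the normalized density `expNegPow p / mass p`. -/
noncomputable def var (p : ℝ) : ℝ := (∫ x, x ^ 2 * expNegPow p x) / mass p

/-- The characteristic function of the normalized density. -/
noncomputable def charFn (p t : ℝ) : ℝ := cosTransform p t / mass p

theorem mass_pos {p : ℝ} (hp : 0 < p) : 0 < mass p := integral_expNegPow_pos hp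

theorem var_pos {p : ℝ} (hp : 0 < p) : 0 < var p := by
  refine div_pos ?_ (mass_pos hp)
  rw [integral_sq_mul_expNegPow hp]
  have := Real.Gamma_pos_of_pos (show 0 < 1 + 3 / p by positivity)
  positivity

/-- Trades the Gamma values for mass and variance, the quantities in which the Gaussian limit is
expressed. -/
theorem limitValue_eq {p : ℝ} (hp : 0 < p) :
    limitValue p = (2 : ℝ) ^ (1 / p) * mass p / (2 * (√Real.pi * √(var p))) := by
  have h1 := Real.Gamma_pos_of_pos (show 0 < 1 + 1 / p by positivity)
  have h3 := Real.Gamma_pos_of_pos (show 0 < 1 + 3 / p by positivity)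
  have hv := var_pos hp
  have hm := mass_pos hp
  have h2 : (2 : ℝ) ^ (2 / p) = ((2 : ℝ) ^ (1 / p)) ^ 2 := by
    rw [← Real.rpow_natCast, ← Real.rpow_mul (by norm_num)]
    congr 1; push_cast; ring
  have h2p : 0 < (2 : ℝ) ^ (1 / p) := by positivity
  have hπ := Real.pi_pos
  rw [limitValue, ← Real.sqrt_mul (by positivity), ← Real.sqrt_mul (by positivity)]
  rw [Real.sqrt_eq_iff_mul_self_eq (by positivity) (by positivity)]
  have hs := Real.mul_self_sqrt (show 0 ≤ Real.pi * var p by positivity)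
  have e : (2 : ℝ) ^ (1 / p) * mass p / (2 * √(Real.pi * var p)) *
      ((2 : ℝ) ^ (1 / p) * mass p / (2 * √(Real.pi * var p))) =
      ((2 : ℝ) ^ (1 / p)) ^ 2 * mass p ^ 2 / (4 * (√(Real.pi * var p) * √(Real.pi * var p))) := by
    field_simp
    ring
  rw [e, hs, h2, var, integral_sq_mul_expNegPow hp, mass, integral_expNegPow hp]
  field_simp
  ring

theorem continuous_charFn {p : ℝ} (hp : 0 < p) : Continuous (charFn p) :=
  (continuous_cosTransform hp).div_const _

theorem charFn_abs (p t : ℝ) : charFn p |t| = charFn p t := by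
  rcases abs_choice t with h | h <;> simp [h, charFn, cosTransform_neg]

theorem charFn_zero {p : ℝ} (hp : 0 < p) : charFn p 0 = 1 := by
  rw [charFn, cosTransform_zero]
  exact div_self (mass_pos hp).ne'

theorem integrable_charFn_pow {p : ℝ} (hp : 2 < p) (n : ℕ) :
    Integrable fun t => charFn p t ^ (n + 1) := by
  simp only [charFn, div_pow]
  exact (integrable_cosTransform_pow hp n).div_const _

theorem one_sub_le_charFn {p : ℝ} (hp : 0 < p) (t : ℝ) : 1 - var p * t ^ 2 / 2 ≤ charFn p t := by
  have hm := mass_pos hp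
  have e : 1 - var p * t ^ 2 / 2 =
      ((∫ x, expNegPow p x) - t ^ 2 / 2 * ∫ x, x ^ 2 * expNegPow p x) / mass p := by
    rw [var, ← mass]; field_simp
  rw [e, charFn]
  refine div_le_div_of_nonneg_right ?_ hm.le
  rw [← integral_const_mul, ← integral_sub (integrable_expNegPow hp)
    ((integrable_sq_mul_expNegPow hp).const_mul _)]
  refine integral_mono ((integrable_expNegPow hp).sub
    ((integrable_sq_mul_expNegPow hp).const_mul _))
    (Integrable.bdd_mul_cos (integrable_expNegPow hp) t) fun x => ?_
  have h := Real.one_sub_sq_div_two_le_cos (x := t * x)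
  have h0 := expNegPow_pos p x
  calc expNegPow p x - t ^ 2 / 2 * (x ^ 2 * expNegPow p x)
      = (1 - (t * x) ^ 2 / 2) * expNegPow p x := by ring
    _ ≤ _ := mul_le_mul_of_nonneg_right h h0.le

theorem abs_slopeFun {p x : ℝ} (hp : 0 < p) (hx : x ≠ 0) :
    |slopeFun p x| = p * (|x| ^ (p - 1) * expNegPow p x) := by
  have hx' := abs_pos.mpr hx
  have e : |x| ^ (p - 1) = |x| ^ (p - 2) * |x| := by
    rw [show p - 1 = (p - 2) + 1 by ring, Real.rpow_add hx', Real.rpow_one]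
  rw [e, slopeFun, abs_mul, abs_mul, abs_mul, abs_of_pos (expNegPow_pos p x), abs_of_pos hp,
    abs_of_nonneg (Real.rpow_nonneg (abs_nonneg x) _)]
  ring

theorem integral_abs_slopeFun {p : ℝ} (hp : 1 < p) : ∫ x, |slopeFun p x| = 2 := by
  have hp0 : 0 < p := by linarith
  have e : (fun x => |slopeFun p x|) = fun x => p * (|x| ^ (p - 1) * expNegPow p x) := by
    ext x
    rcases eq_or_ne x 0 with rfl | hx
    · simp [slopeFun, Real.zero_rpow (show p - 1 ≠ 0 by linarith)]
    · exact abs_slopeFun hp0 hx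
  rw [e, integral_const_mul, integral_abs_rpow_mul_expNegPow hp0 (by linarith), sub_add_cancel,
    div_self hp0.ne', Real.Gamma_one]
  field_simp

theorem mul_slopeFun {p : ℝ} (hp : 0 < p) (x : ℝ) :
    x * slopeFun p x = p * (|x| ^ p * expNegPow p x) := by
  rcases eq_or_ne x 0 with rfl | hx
  · simp [Real.zero_rpow hp.ne']
  · have hx' := abs_pos.mpr hx
    have e : |x| ^ p = |x| ^ (p - 2) * (x * x) := by
      rw [← abs_mul_abs_self x]
      nth_rw 1 [show p = (p - 2) + 1 + 1 by ring]
      rw [Real.rpow_add hx', Real.rpow_add hx', Real.rpow_one]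
      ring
    rw [e, slopeFun]; ring

theorem integrable_mul_slopeFun {p : ℝ} (hp : 0 < p) : Integrable fun x => x * slopeFun p x := by
  simp_rw [mul_slopeFun hp]
  exact (integrable_abs_rpow_mul_expNegPow hp (by linarith)).const_mul p

theorem integral_mul_slopeFun {p : ℝ} (hp : 0 < p) : ∫ x, x * slopeFun p x = mass p := by
  simp_rw [mul_slopeFun hp]
  rw [integral_const_mul, integral_abs_rpow_mul_expNegPow hp (by linarith), mass,
    integral_expNegPow hp, add_div, div_self hp.ne']
  field_simp

/-- One integration by parts; the 2 is the total variation of the density, which rises to 1 and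
falls back. -/
theorem abs_mul_charFn_le {p : ℝ} (hp : 1 < p) (t : ℝ) : |t| * |charFn p t| ≤ 2 / mass p := by
  have hm := mass_pos (p := p) (by linarith)
  rw [charFn, abs_div, abs_of_pos hm, mul_div_assoc', ← abs_mul, mul_cosTransform hp]
  refine div_le_div_of_nonneg_right ?_ hm.le
  rw [← integral_abs_slopeFun hp]
  exact abs_integral_sin_mul_le (integrable_slopeFun hp) t

theorem neg_sq_div_pi_le_mul_sin (z : ℝ) : -(z ^ 2 / Real.pi) ≤ z * Real.sin z := by
  have hπ := Real.pi_pos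
  have key : ∀ z : ℝ, 0 ≤ z → -(z ^ 2 / Real.pi) ≤ z * Real.sin z := by
    intro z hz
    rcases le_total z Real.pi with h | h
    · have h1 : 0 ≤ z * Real.sin z := mul_nonneg hz (Real.sin_nonneg_of_nonneg_of_le_pi hz h)
      have h2 : 0 ≤ z ^ 2 / Real.pi := by positivity
      linarith
    · have h1 : z ≤ z ^ 2 / Real.pi := by
        rw [le_div_iff₀ hπ]; nlinarith
      have h2 := mul_le_mul_of_nonneg_left (Real.neg_one_le_sin z) hz
      linarith
  rcases le_total 0 z with h | h
  · exact key z h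
  · simpa using key (-z) (by linarith)

/-- The density is a mixture of uniform densities on symmetric intervals. Thus φ(t) averages
sin(tx)/(tx) against the probability weight x · `slopeFun p x` / `mass p`, and sin(z)/z ≥ -1/π. -/
theorem neg_inv_pi_le_charFn {p : ℝ} (hp : 1 < p) (t : ℝ) : -(1 / Real.pi) ≤ charFn p t := by
  have hp0 : 0 < p := by linarith
  have hm := mass_pos hp0
  have hπ := Real.pi_pos
  rcases eq_or_ne t 0 with rfl | ht
  · rw [charFn_zero hp0]
    have : 0 < 1 / Real.pi := by positivity
    linarith
  · have hc : cosTransform p t = ∫ x, t⁻¹ * (Real.sin (t * x) * slopeFun p x) := by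
      rw [integral_const_mul, ← mul_cosTransform hp]
      field_simp
    rw [charFn, le_div_iff₀ hm, hc, ← integral_mul_slopeFun hp0, ← integral_const_mul]
    refine integral_mono ((integrable_mul_slopeFun hp0).const_mul _)
      ((Integrable.bdd_mul_sin (integrable_slopeFun hp) t).const_mul _) fun x => ?_
    have h := neg_sq_div_pi_le_mul_sin (t * x)
    have hw : 0 ≤ p * |x| ^ (p - 2) * expNegPow p x * (t⁻¹) ^ 2 := by
      have := expNegPow_pos p x
      positivity
    have h' := mul_le_mul_of_nonneg_left h hw
    simp only [slopeFun]
    calc -(1 / Real.pi) * (x * (p * (|x| ^ (p - 2) * x) * expNegPow p x))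
        = p * |x| ^ (p - 2) * expNegPow p x * t⁻¹ ^ 2 * -((t * x) ^ 2 / Real.pi) := by
          field_simp
      _ ≤ _ := h'
      _ = _ := by field_simp

/-! ### Wallis integrals -/

/-- The integrals `∫₀¹ (1 - s²)ⁿ ds`. -/
noncomputable def betaHalf (n : ℕ) : ℝ := ∫ s in (0 : ℝ)..1, (1 - s ^ 2) ^ n

theorem betaHalf_zero : betaHalf 0 = 1 := by simp [betaHalf]

/-- Integrate the derivative of s(1 - s²)^(n+1), which vanishes at both endpoints. -/
theorem betaHalf_succ (n : ℕ) : (2 * n + 3) * betaHalf (n + 1) = (2 * n + 2) * betaHalf n := by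
  have h := intervalIntegral.integral_eq_sub_of_hasDerivAt (a := (0 : ℝ)) (b := 1)
    (f := fun s : ℝ => s * (1 - s ^ 2) ^ (n + 1))
    (f' := fun s => (2 * n + 3) * (1 - s ^ 2) ^ (n + 1) - (2 * n + 2) * (1 - s ^ 2) ^ n)
    (fun s _ => by
      have h1 : HasDerivAt (fun s : ℝ => 1 - s ^ 2) (-(2 * s)) s := by
        simpa using (hasDerivAt_pow 2 s).const_sub 1
      refine ((hasDerivAt_id s).mul (h1.pow (n + 1))).congr_deriv ?_
      simp only [id, Nat.add_sub_cancel, Pi.pow_apply]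
      push_cast
      ring)
    (by apply Continuous.intervalIntegrable; fun_prop)
  rw [intervalIntegral.integral_sub (by apply Continuous.intervalIntegrable; fun_prop)
    (by apply Continuous.intervalIntegrable; fun_prop), intervalIntegral.integral_const_mul,
    intervalIntegral.integral_const_mul] at h
  simp only [betaHalf]
  norm_num at h
  linarith

theorem betaHalf_pos (n : ℕ) : 0 < betaHalf n := by
  induction n with
  | zero => rw [betaHalf_zero]; norm_num
  | succ n ih =>
    have h := betaHalf_succ n
    have : 0 < (2 * n + 3 : ℝ) * betaHalf (n + 1) := by rw [h]; positivity
    exact pos_of_mul_pos_right this (by positivity)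

theorem betaHalf_sq_eq (n : ℕ) : betaHalf n ^ 2 * (2 * n + 1) = Real.Wallis.W n := by
  induction n with
  | zero => simp [betaHalf_zero, Real.Wallis.W]
  | succ n ih =>
    have h : betaHalf (n + 1) = (2 * n + 2) / (2 * n + 3) * betaHalf n := by
      have := betaHalf_succ n
      field_simp
      linarith
    rw [Real.Wallis.W_succ, ← ih, h]
    push_cast
    field_simp
    ring

/-- The right side decreases in n and tends to π/4 by Wallis. The shifts 1/2 and 1/4 are chosen so
that the resulting bound has the correction 1 - 3/(4n). -/
theorem pi_div_four_le_betaHalf (n : ℕ) :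
    Real.pi / 4 ≤ betaHalf n ^ 2 * ((n + 1 / 2) ^ 2 / (n + 1 / 4)) := by
  set u : ℕ → ℝ := fun n => betaHalf n ^ 2 * ((n + 1 / 2) ^ 2 / (n + 1 / 4)) with hu
  have hanti : Antitone u := by
    refine antitone_nat_of_succ_le fun n => ?_
    have h : betaHalf (n + 1) = (2 * n + 2) / (2 * n + 3) * betaHalf n := by
      have := betaHalf_succ n
      field_simp
      linarith
    simp only [hu, h]
    push_cast
    rw [mul_pow, mul_comm _ (betaHalf n ^ 2), mul_assoc]
    refine mul_le_mul_of_nonneg_left ?_ (sq_nonneg _)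
    rw [div_pow, div_mul_div_comm, div_le_div_iff₀ (by positivity) (by positivity)]
    have hn : (0 : ℝ) ≤ n := Nat.cast_nonneg n
    have : ((n : ℝ) + 1) ^ 2 * (n + 1 / 4) ≤ (n + 1 + 1 / 4) * (n + 1 / 2) ^ 2 := by
      nlinarith
    have h4 : (0:ℝ) ≤ 4 * (n + 1 + 1 / 2) ^ 2 := by positivity
    nlinarith [mul_le_mul_of_nonneg_left this h4]
  have hlim : Tendsto u atTop (𝓝 (Real.pi / 4)) := by
    have h1 := Real.Wallis.tendsto_W_nhds_pi_div_two
    have h2 : Tendsto (fun n : ℕ => ((n : ℝ) + 1 / 2) / (2 * (n + 1 / 4))) atTop (𝓝 (1 / 2)) := by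
      have h3 : Tendsto (fun n : ℕ => (n : ℝ) + 1 / 4) atTop atTop :=
        tendsto_atTop_add_const_right _ _ tendsto_natCast_atTop_atTop
      have h4 := ((h3.inv_tendsto_atTop).const_mul (1 / 8)).const_add (1 / 2)
      simp only [mul_zero, add_zero] at h4
      refine h4.congr fun n => ?_
      simp only [Pi.inv_apply]
      field_simp
      ring
    have h5 := h1.mul h2
    rw [show Real.pi / 2 * (1 / 2) = Real.pi / 4 by ring] at h5
    refine h5.congr fun n => ?_
    simp only [hu]
    rw [← betaHalf_sq_eq]
    field_simp
  exact hanti.le_of_tendsto hlim n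

/-! ### Lower bounds for finite n -/

theorem integral_even_eq_two_mul {f : ℝ → ℝ} (hf : ∀ t, f |t| = f t) :
    ∫ t, f t = 2 * ∫ t in Set.Ioi 0, f t := by
  rw [← integral_comp_abs]
  simp only [hf]

theorem integral_Ioi_inv_sq {T : ℝ} (hT : 0 < T) :
    IntegrableOn (fun t : ℝ => (t ^ 2)⁻¹) (Set.Ioi T) ∧ ∫ t in Set.Ioi T, (t ^ 2)⁻¹ = T⁻¹ := by
  have e : ∀ t ∈ Set.Ioi T, t ^ (-2 : ℝ) = (t ^ 2)⁻¹ := fun t ht => by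
    rw [Real.rpow_neg (hT.trans ht).le, Real.rpow_two]
  refine ⟨(integrableOn_Ioi_rpow_of_lt (by norm_num : (-2 : ℝ) < -1) hT).congr_fun e
    measurableSet_Ioi, ?_⟩
  rw [← setIntegral_congr_fun measurableSet_Ioi e, integral_Ioi_rpow_of_lt (by norm_num) hT]
  norm_num
  rw [Real.rpow_neg hT.le, Real.rpow_one]

theorem integral_charFn_pow_ge {p : ℝ} (hp : 2 < p) (k : ℕ) :
    2 * √(2 / var p) * (betaHalf (k + 2) -
      (1 / Real.pi) ^ k * (2 * var p / mass p ^ 2)) ≤ ∫ t, charFn p t ^ (k + 2) := by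
  have hp0 : 0 < p := by linarith
  have hv := var_pos hp0
  have hm := mass_pos hp0
  have hπ := Real.pi_pos
  -- T is the positive zero of the parabola 1 - v t²/2. On [0, T] the parabola is a nonnegative
  -- minorant of φ, so it may be raised to a power.
  set T := √(2 / var p) with hTdef
  have hT : 0 < T := Real.sqrt_pos.mpr (by positivity)
  have hT2 : T ^ 2 = 2 / var p := Real.sq_sqrt (by positivity)
  have hint := integrable_charFn_pow hp (k + 1)
  rw [integral_even_eq_two_mul (f := fun t => charFn p t ^ (k + 2)) (fun t => by rw [charFn_abs]),
    ← Set.Ioc_union_Ioi_eq_Ioi hT.le,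
    setIntegral_union Set.Ioc_disjoint_Ioi_same measurableSet_Ioi hint.integrableOn
      hint.integrableOn, mul_assoc]
  refine mul_le_mul_of_nonneg_left ?_ (by norm_num)
  have hmain : T * betaHalf (k + 2) ≤ ∫ t in Set.Ioc 0 T, charFn p t ^ (k + 2) := by
    have hsub := intervalIntegral.integral_comp_mul_left (a := 0) (b := T)
      (fun s : ℝ => (1 - s ^ 2) ^ (k + 2)) (inv_ne_zero hT.ne')
    rw [mul_zero, inv_mul_cancel₀ hT.ne', inv_inv, smul_eq_mul] at hsub
    rw [betaHalf, ← hsub, intervalIntegral.integral_of_le hT.le]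
    refine setIntegral_mono_on ?_ hint.integrableOn measurableSet_Ioc fun t ht => ?_
    · exact (Continuous.integrableOn_Icc (by fun_prop)).mono_set Set.Ioc_subset_Icc_self
    · have e : 1 - (T⁻¹ * t) ^ 2 = 1 - var p * t ^ 2 / 2 := by
        rw [mul_pow, inv_pow, hT2]; field_simp
      have h0 : 0 ≤ 1 - (T⁻¹ * t) ^ 2 := by
        have h1 : T⁻¹ * t ≤ 1 := by
          rw [inv_mul_le_iff₀ hT]; simpa using ht.2
        have h2 : 0 ≤ T⁻¹ * t := mul_nonneg (inv_pos.mpr hT).le ht.1.le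
        nlinarith
      exact pow_le_pow_left₀ h0 (e ▸ one_sub_le_charFn hp0 t) _
  -- Where φ is negative, k of the k + 2 factors are bounded by 1/π and the other two by 2/(M t),
  -- with M the mass, to keep integrability at infinity.
  have htail : -((1 / Real.pi) ^ k * (4 / mass p ^ 2) * T⁻¹) ≤
      ∫ t in Set.Ioi T, charFn p t ^ (k + 2) := by
    obtain ⟨hi, hI⟩ := integral_Ioi_inv_sq hT
    rw [← hI, ← integral_const_mul, ← integral_neg]
    refine setIntegral_mono_on (hi.const_mul _).neg hint.integrableOn measurableSet_Ioi
      fun t ht => ?_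
    have ht0 : 0 < t := hT.trans ht
    have hnn : 0 ≤ (1 / Real.pi) ^ k * (4 / mass p ^ 2) * (t ^ 2)⁻¹ := by positivity
    rcases le_or_gt 0 (charFn p t) with h | h
    · have := pow_nonneg h (k + 2)
      linarith
    · have h1 : |charFn p t| ≤ 1 / Real.pi := by
        rw [abs_of_neg h]; linarith [neg_inv_pi_le_charFn (p := p) (by linarith) t]
      have h2 : |charFn p t| ≤ 2 / mass p / t := by
        rw [le_div_iff₀ ht0, mul_comm]
        simpa [abs_of_pos ht0] using abs_mul_charFn_le (p := p) (by linarith) t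
      have h3 : |charFn p t ^ (k + 2)| ≤ (1 / Real.pi) ^ k * (4 / mass p ^ 2) * (t ^ 2)⁻¹ := by
        rw [abs_pow, pow_add]
        calc |charFn p t| ^ k * |charFn p t| ^ 2 ≤ (1 / Real.pi) ^ k * (2 / mass p / t) ^ 2 := by
              gcongr
          _ = _ := by field_simp; ring
      linarith [neg_abs_le (charFn p t ^ (k + 2))]
  refine le_trans (le_of_eq ?_) (add_le_add hmain htail)
  have : T⁻¹ = T * (var p / 2) := by
    field_simp; rw [hT2]; field_simp
  rw [this]
  ring

theorem sectionFun_ratio {p : ℝ} (hp : 2 < p) {m : ℕ} (hm : m ≠ 0) :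
    sectionFun (m + 1) p (diagDir (m + 1)) / sectionFun (m + 1) p (pairDir (m + 1)) =
      limitValue p * (√(var p) / √(2 * Real.pi) * √((m + 1 : ℕ) : ℝ) *
        ∫ t, charFn p t ^ (m + 1)) := by
  have hp0 : 0 < p := by linarith
  have hv := Real.sqrt_pos.mpr (var_pos hp0)
  have hM := mass_pos hp0
  have hπ := Real.pi_pos
  have hπ' := Real.sqrt_pos.mpr hπ
  have h2 : 0 < (2 : ℝ) ^ (1 / p) := by positivity
  rw [sectionFun_diagDir hp hm, sectionFun_pairDir hp hm, limitValue_eq hp0, ← mass,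
    Real.rpow_neg (by norm_num)]
  simp only [charFn, div_pow, integral_div]
  rw [Real.sqrt_mul (by norm_num) Real.pi, pow_succ (mass p)]
  have hs := Real.mul_self_sqrt hπ.le
  generalize ∫ t, cosTransform p t ^ (m + 1) = J
  have h22 : √(2 : ℝ) * √2 = 2 := Real.mul_self_sqrt (by norm_num)
  generalize √Real.pi = s at *
  rw [← hs]
  field_simp

/-- Since g² = 2^(2/p) M²/(4πv) with M the mass and v the variance, and 2^(2/p) ≤ 2, the condition g
≥ 1 forces M² ≥ 2πv. This removes the p-dependence from the tail error. -/
theorem mass_sq_eq {p : ℝ} (hp : 2 < p) (hg : 1 ≤ limitValue p) :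
    2 * var p / mass p ^ 2 ≤ 1 / Real.pi := by
  have hp0 : 0 < p := by linarith
  have hv := var_pos hp0
  have hv' := Real.sqrt_pos.mpr hv
  have hM := mass_pos hp0
  have hπ := Real.pi_pos
  have hπ' := Real.sqrt_pos.mpr hπ
  have h2 : ((2 : ℝ) ^ (1 / p)) ^ 2 ≤ 2 := by
    rw [← Real.rpow_natCast, ← Real.rpow_mul (by norm_num)]
    nth_rw 2 [← Real.rpow_one 2]
    refine Real.rpow_le_rpow_of_exponent_le (by norm_num) ?_
    push_cast
    rw [div_mul_eq_mul_div, div_le_one hp0]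
    linarith
  have h2p : 0 < (2 : ℝ) ^ (1 / p) := by positivity
  rw [limitValue_eq hp0, le_div_iff₀ (by positivity), one_mul] at hg
  have h := pow_le_pow_left₀ (by positivity) hg 2
  rw [mul_pow, mul_pow, mul_pow, Real.sq_sqrt hπ.le, Real.sq_sqrt hv.le] at h
  rw [div_le_div_iff₀ (by positivity) hπ]
  nlinarith [mul_le_mul_of_nonneg_right h2 (sq_nonneg (mass p))]

theorem sectionFun_ratio_ge {p : ℝ} (hp : 2 < p) (hg : 1 ≤ limitValue p) (k : ℕ) :
    limitValue p * (2 / √Real.pi * √((k + 2 : ℕ) : ℝ) *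
      (betaHalf (k + 2) - (1 / Real.pi) ^ (k + 1))) ≤
    sectionFun (k + 2) p (diagDir (k + 2)) / sectionFun (k + 2) p (pairDir (k + 2)) := by
  have hp0 : 0 < p := by linarith
  have hv := var_pos hp0
  have hv' := Real.sqrt_pos.mpr hv
  have hπ := Real.pi_pos
  have hπ' := Real.sqrt_pos.mpr hπ
  rw [sectionFun_ratio hp (m := k + 1) (by omega)]
  refine mul_le_mul_of_nonneg_left ?_ (by linarith)
  have h1 := integral_charFn_pow_ge hp k
  have h2 : √(2 / var p) = √2 / √(var p) := Real.sqrt_div (by norm_num) _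
  have h3 : (1 / Real.pi) ^ k * (2 * var p / mass p ^ 2) ≤ (1 / Real.pi) ^ (k + 1) := by
    rw [pow_succ]
    exact mul_le_mul_of_nonneg_left (mass_sq_eq hp hg) (by positivity)
  have h4 : 2 * √(2 / var p) * (betaHalf (k + 2) - (1 / Real.pi) ^ (k + 1)) ≤
      ∫ t, charFn p t ^ (k + 2) := by
    refine le_trans (mul_le_mul_of_nonneg_left ?_ (by positivity)) h1
    linarith
  have h5 := mul_le_mul_of_nonneg_left h4
    (show 0 ≤ √(var p) / √(2 * Real.pi) * √((k + 2 : ℕ) : ℝ) by positivity)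
  refine le_trans (le_of_eq ?_) h5
  rw [h2, Real.sqrt_mul (by norm_num) Real.pi]
  have h22 : √(2 : ℝ) ≠ 0 := by positivity
  field_simp

theorem inv_three_pow_mul_sq_le {j : ℕ} (hj : 18 ≤ j) :
    (1 / 3 : ℝ) ^ (j + 1) * (2000 * ((j + 2 : ℕ) : ℝ) ^ 2) ≤ 1 := by
  induction j, hj using Nat.le_induction with
  | base => norm_num
  | succ j hj ih =>
    refine le_trans ?_ ih
    rw [pow_succ, mul_assoc]
    refine mul_le_mul_of_nonneg_left ?_ (by positivity)
    push_cast
    have : (18 : ℝ) ≤ j := by exact_mod_cast hj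
    nlinarith

theorem one_sub_le_sq_betaHalf {n : ℕ} (hn : 0 < n) :
    1 - 3 / (4 * (n : ℝ)) ≤ (2 / √Real.pi * √n * betaHalf n) ^ 2 := by
  have hn' : (0 : ℝ) < n := by exact_mod_cast hn
  have hπ := Real.pi_pos
  have h := pi_div_four_le_betaHalf n
  rw [mul_div_assoc', le_div_iff₀ (by linarith)] at h
  rw [mul_pow, mul_pow, div_pow, Real.sq_sqrt hn'.le, Real.sq_sqrt hπ.le]
  have h1 : (n : ℝ) * (n + 1 / 4) ≤
      2 ^ 2 / Real.pi * n * betaHalf n ^ 2 * (n + 1 / 2) ^ 2 := by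
    calc (n : ℝ) * (n + 1 / 4) = 4 / Real.pi * n * (Real.pi / 4 * (n + 1 / 4)) := by field_simp
      _ ≤ 4 / Real.pi * n * (betaHalf n ^ 2 * (n + 1 / 2) ^ 2) :=
        mul_le_mul_of_nonneg_left h (by positivity)
      _ = _ := by ring
  have h2 : (1 - 3 / (4 * (n : ℝ))) * (n + 1 / 2) ^ 2 ≤ n * (n + 1 / 4) := by
    have e2 : (1 - 3 / (4 * (n : ℝ))) * (n + 1 / 2) ^ 2 =
        n * (n + 1 / 4) - (1 / 2 + 3 / (16 * n)) := by
      field_simp; ring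
    rw [e2]
    have : 0 < 3 / (16 * (n : ℝ)) := by positivity
    linarith
  exact le_of_mul_le_mul_right (h2.trans h1) (by positivity)

/-- Here r plays the role of 1/n, w of the Wallis main term and δ of the tail. The gain 0.9 r beats
the loss 0.75 r, with 0.753 r absorbing δ, and r ≤ 1/20 controls the quadratic term. -/
theorem one_lt_mul_sub_of_sq_bounds {g w δ r : ℝ} (hr0 : 0 < r) (hr1 : r ≤ 1 / 20) (hg0 : 0 ≤ g)
    (hg : 1 + 0.9 * r ≤ g ^ 2) (hw0 : 0 < w) (hw2 : 1 - 3 / 4 * r ≤ w ^ 2) (hδ0 : 0 ≤ δ)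
    (hδ1 : δ ≤ r / 1000) : 1 < g * (w - δ) := by
  have hw1 : 0.9 ≤ w := by
    by_contra hc
    push Not at hc
    nlinarith
  have hwδ : 0 < w - δ := by linarith
  have hsq : 1 - 0.753 * r ≤ (w - δ) ^ 2 := by
    rcases le_total w 1 with h | h
    · have h1 : δ * w ≤ δ := mul_le_of_le_one_right hδ0 h
      have h2 := sq_nonneg δ
      calc 1 - 0.753 * r ≤ w ^ 2 - 2 * δ := by linarith
        _ ≤ w ^ 2 - 2 * (δ * w) + δ ^ 2 := by linarith
        _ = _ := by ring
    · have h1 : 1 - δ ≤ w - δ := by linarith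
      have h2 : (1 - δ) ^ 2 ≤ (w - δ) ^ 2 := pow_le_pow_left₀ (by linarith) h1 2
      have h3 := sq_nonneg δ
      calc 1 - 0.753 * r ≤ 1 - 2 * δ := by linarith
        _ ≤ (1 - δ) ^ 2 := by linarith [show (1 - δ) ^ 2 = 1 - 2 * δ + δ ^ 2 by ring]
        _ ≤ _ := h2
  have hquad : 0 < r * (0.147 - 0.6777 * r) := mul_pos hr0 (by linarith)
  have : 1 < (g * (w - δ)) ^ 2 := by
    rw [mul_pow]
    calc (1 : ℝ) < 1 + r * (0.147 - 0.6777 * r) := by linarith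
      _ = (1 + 0.9 * r) * (1 - 0.753 * r) := by ring
      _ ≤ g ^ 2 * (w - δ) ^ 2 := mul_le_mul hg hsq (by linarith) (sq_nonneg g)
  exact lt_of_pow_lt_pow_left₀ 2 (mul_nonneg hg0 hwδ.le) (by simpa using this)

theorem one_lt_mul_betaHalf {g : ℝ} {k : ℕ} (hk : 18 ≤ k)
    (hg0 : 0 ≤ g) (hg : 1 + 0.9 / ((k + 2 : ℕ) : ℝ) ≤ g ^ 2) :
    1 < g * (2 / √Real.pi * √((k + 2 : ℕ) : ℝ) *
      (betaHalf (k + 2) - (1 / Real.pi) ^ (k + 1))) := by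
  have hn20 : (20 : ℝ) ≤ ((k + 2 : ℕ) : ℝ) := by exact_mod_cast (by omega : 20 ≤ k + 2)
  have hb := betaHalf_pos (k + 2)
  have hw2 := one_sub_le_sq_betaHalf (n := k + 2) (by omega)
  have hexp := inv_three_pow_mul_sq_le hk
  generalize ((k + 2 : ℕ) : ℝ) = n at *
  generalize betaHalf (k + 2) = b at *
  have hn0 : 0 < n := by linarith
  have hπ := Real.pi_pos
  have hπ3 := Real.pi_gt_three
  have hπ' := Real.sqrt_pos.mpr hπ
  have hsn0 : 0 < √n := Real.sqrt_pos.mpr hn0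
  have hsmall : (1 / Real.pi) ^ (k + 1) ≤ 1 / (2000 * n ^ 2) := by
    rw [le_div_iff₀ (by positivity)]
    refine le_trans (mul_le_mul_of_nonneg_right ?_ (by positivity)) hexp
    exact pow_le_pow_left₀ (by positivity) (one_div_le_one_div_of_le (by norm_num) hπ3.le) _
  have hδ1 : 2 / √Real.pi * √n * (1 / Real.pi) ^ (k + 1) ≤ 1 / n / 1000 := by
    have h1 : 2 / √Real.pi ≤ 2 := by
      rw [div_le_iff₀ hπ']
      have : (1 : ℝ) ≤ √Real.pi := Real.one_le_sqrt.mpr (by linarith)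
      linarith
    have h2 : √n ≤ n := by
      rw [Real.sqrt_le_left hn0.le]
      nlinarith
    calc 2 / √Real.pi * √n * (1 / Real.pi) ^ (k + 1) ≤ 2 * n * (1 / (2000 * n ^ 2)) := by gcongr
      _ = _ := by field_simp; norm_num
  rw [mul_sub]
  refine one_lt_mul_sub_of_sq_bounds (r := 1 / n) (by positivity)
    (one_div_le_one_div_of_le (by norm_num) hn20) hg0 (by rwa [mul_one_div]) (by positivity)
    (le_of_eq_of_le ?_ hw2) (by positivity) hδ1
  field_simp

/-! ### The limit n → ∞ -/

theorem cos_le_one_sub_add_pow_four (x : ℝ) : Real.cos x ≤ 1 - x ^ 2 / 2 + x ^ 4 := by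
  rcases le_or_gt |x| 1 with h | h
  · have h1 := abs_le.mp (Real.cos_bound h)
    have h2 : |x| ^ 4 = x ^ 4 := by rw [← abs_pow, abs_of_nonneg (by positivity)]
    rw [h2] at h1
    have : 0 ≤ x ^ 4 := by positivity
    linarith
  · have h1 : 1 ≤ x ^ 2 := by
      rw [← sq_abs]; nlinarith
    have h2 := Real.cos_le_one x
    nlinarith

theorem integrable_pow_four_mul_expNegPow {p : ℝ} (hp : 0 < p) :
    Integrable fun x => x ^ 4 * expNegPow p x := by
  have h := integrable_abs_rpow_mul_expNegPow hp (s := (4 : ℕ)) (by norm_num)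
  have e : ∀ x : ℝ, |x| ^ ((4 : ℕ) : ℝ) = x ^ 4 := fun x => by
    rw [Real.rpow_natCast, ← abs_pow, abs_of_nonneg (by positivity)]
  simpa only [e] using h

theorem exists_charFn_le {p : ℝ} (hp : 0 < p) :
    ∃ q, 0 < q ∧ ∀ t, charFn p t ≤ 1 - var p * t ^ 2 / 2 + q * t ^ 4 := by
  have hm := mass_pos hp
  -- The added 1 makes positivity immediate; only the existence of a constant matters.
  refine ⟨(∫ x, x ^ 4 * expNegPow p x) / mass p + 1, ?_, fun t => ?_⟩
  · have : 0 ≤ ∫ x, x ^ 4 * expNegPow p x := integral_nonneg fun x => by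
      have := expNegPow_pos p x
      positivity
    positivity
  · refine le_trans ?_ (show 1 - var p * t ^ 2 / 2 +
      (∫ x, x ^ 4 * expNegPow p x) / mass p * t ^ 4 ≤ _ by
        have : 0 ≤ t ^ 4 := by positivity
        linarith)
    have e : 1 - var p * t ^ 2 / 2 + (∫ x, x ^ 4 * expNegPow p x) / mass p * t ^ 4 =
        ((∫ x, expNegPow p x) - t ^ 2 / 2 * (∫ x, x ^ 2 * expNegPow p x) +
          t ^ 4 * ∫ x, x ^ 4 * expNegPow p x) / mass p := by
      rw [var, ← mass]; field_simp
    have i1 := integrable_expNegPow hp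
    have i2 := (integrable_sq_mul_expNegPow hp).const_mul (t ^ 2 / 2)
    have i4 := (integrable_pow_four_mul_expNegPow hp).const_mul (t ^ 4)
    rw [e, charFn]
    refine div_le_div_of_nonneg_right ?_ hm.le
    have i12 : Integrable fun x => expNegPow p x - t ^ 2 / 2 * (x ^ 2 * expNegPow p x) :=
      i1.sub i2
    rw [← integral_const_mul, ← integral_const_mul, ← integral_sub i1 i2, ← integral_add i12 i4]
    refine integral_mono (Integrable.bdd_mul_cos i1 t) (i12.add i4) fun x => ?_
    have h := mul_le_mul_of_nonneg_right (cos_le_one_sub_add_pow_four (t * x))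
      (expNegPow_pos p x).le
    refine h.trans (le_of_eq ?_)
    ring

theorem integral_mul_expNegPow_pos {p : ℝ} (hp : 0 < p) {f : ℝ → ℝ} (hf : Continuous f)
    (h0 : ∀ x, 0 ≤ f x) (hi : Integrable fun x => f x * expNegPow p x) {x₀ : ℝ} (hx₀ : f x₀ ≠ 0) :
    0 < ∫ x, f x * expNegPow p x := by
  rw [integral_pos_iff_support_of_nonneg (fun x => mul_nonneg (h0 x) (expNegPow_pos p x).le) hi]
  exact (hf.mul (continuous_expNegPow hp)).isOpen_support.measure_pos _
    ⟨x₀, mul_ne_zero hx₀ (expNegPow_pos p x₀).ne'⟩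

theorem abs_charFn_lt_one {p : ℝ} (hp : 0 < p) {t : ℝ} (ht : t ≠ 0) : |charFn p t| < 1 := by
  have hi := integrable_expNegPow hp
  have hc := Integrable.bdd_mul_cos hi t
  have hm := mass_pos hp
  have h1 := integral_mul_expNegPow_pos hp (f := fun x => 1 - Real.cos (t * x)) (by fun_prop)
    (fun x => by linarith [Real.cos_le_one (t * x)])
    (by simpa only [sub_mul, one_mul] using! hi.sub hc) (x₀ := Real.pi / t) (by
      rw [mul_div_cancel₀ _ ht, Real.cos_pi]; norm_num)
  have h2 := integral_mul_expNegPow_pos hp (f := fun x => 1 + Real.cos (t * x)) (by fun_prop)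
    (fun x => by linarith [Real.neg_one_le_cos (t * x)])
    (by simpa only [add_mul, one_mul] using! hi.add hc) (x₀ := 0) (by simp)
  simp only [sub_mul, one_mul, add_mul] at h1 h2
  rw [integral_sub hi hc] at h1
  rw [integral_add hi hc] at h2
  rw [charFn, abs_div, abs_of_pos hm, div_lt_one hm, abs_lt, mass, cosTransform]
  constructor <;> linarith

/-- Compactness gives a maximum below 1 on [δ, R]; beyond R ≥ 4/M, with M the mass, the decay
2/(M|t|) already yields 1/2. -/
theorem exists_abs_charFn_le_of_le {p : ℝ} (hp : 1 < p) {δ : ℝ} (hδ : 0 < δ) :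
    ∃ q, 0 ≤ q ∧ q < 1 ∧ ∀ t, δ ≤ |t| → |charFn p t| ≤ q := by
  have hp0 : 0 < p := by linarith
  have hm := mass_pos hp0
  set R := max δ (4 / mass p) with hR
  obtain ⟨t₀, ht₀, hmax⟩ := (isCompact_Icc (a := δ) (b := R)).exists_isMaxOn
    (Set.nonempty_Icc.mpr (le_max_left _ _)) (continuous_charFn hp0).abs.continuousOn
  have hlt : |charFn p t₀| < 1 := abs_charFn_lt_one hp0 (hδ.trans_le ht₀.1).ne'
  refine ⟨max |charFn p t₀| (1 / 2), by positivity, max_lt hlt (by norm_num), fun t ht => ?_⟩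
  rcases le_or_gt |t| R with h | h
  · refine le_max_of_le_left ?_
    rw [← charFn_abs]
    exact hmax ⟨ht, h⟩
  · refine le_max_of_le_right ?_
    have h1 := abs_mul_charFn_le hp t
    have h2 : 4 / mass p ≤ |t| := (le_max_right _ _).trans h.le
    have h3 : 0 < 2 / mass p := by positivity
    have h4 : 4 / mass p = 2 * (2 / mass p) := by ring
    have h5 := mul_le_mul_of_nonneg_right h2 (abs_nonneg (charFn p t))
    rw [h4] at h5
    have : 2 / mass p * (2 * |charFn p t|) ≤ 2 / mass p * 1 := by linarith
    have := le_of_mul_le_mul_left this h3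
    linarith

theorem exists_abs_charFn_le_exp {p : ℝ} (hp : 0 < p) :
    ∃ c δ : ℝ, 0 < c ∧ 0 < δ ∧ ∀ t, |t| ≤ δ → |charFn p t| ≤ Real.exp (-c * t ^ 2) := by
  obtain ⟨q, hq, hle⟩ := exists_charFn_le hp
  have hv := var_pos hp
  -- The first radius lets the quartic error consume at most half of the quadratic term; the second
  -- keeps φ nonnegative, so the absolute value can be dropped.
  refine ⟨var p / 4, min √(var p / (4 * q)) √(2 / var p), by positivity,
    lt_min (Real.sqrt_pos.mpr (by positivity)) (Real.sqrt_pos.mpr (by positivity)),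
    fun t ht => ?_⟩
  have h1 : t ^ 2 ≤ var p / (4 * q) := by
    have := ht.trans (min_le_left _ _)
    rwa [Real.le_sqrt (abs_nonneg _) (by positivity), sq_abs] at this
  have h2 : t ^ 2 ≤ 2 / var p := by
    have := ht.trans (min_le_right _ _)
    rwa [Real.le_sqrt (abs_nonneg _) (by positivity), sq_abs] at this
  rw [le_div_iff₀ (by positivity)] at h1 h2
  have h3 := hle t
  have h4 := one_sub_le_charFn hp t
  have h5 := Real.add_one_le_exp (-(var p / 4) * t ^ 2)
  rw [abs_of_nonneg (by linarith)]
  have h6 : q * t ^ 4 ≤ var p / 4 * t ^ 2 := by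
    have := mul_le_mul_of_nonneg_right h1 (sq_nonneg t)
    linarith [show q * t ^ 4 = t ^ 2 * (4 * q) * t ^ 2 / 4 by ring]
  linarith

theorem tendsto_charFn_pow {p : ℝ} (hp : 0 < p) (u : ℝ) :
    Tendsto (fun n : ℕ => charFn p (u / √n) ^ n) atTop (𝓝 (Real.exp (-(var p / 2) * u ^ 2))) := by
  obtain ⟨q, hq, hle⟩ := exists_charFn_le hp
  have h : Tendsto (fun n : ℕ => (n : ℝ) * (charFn p (u / √n) - 1)) atTop
      (𝓝 (-(var p / 2) * u ^ 2)) := by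
    have hup : Tendsto (fun n : ℕ => -(var p / 2) * u ^ 2 + q * u ^ 4 * (n : ℝ)⁻¹) atTop
        (𝓝 (-(var p / 2) * u ^ 2)) := by
      have := ((tendsto_inv_atTop_nhds_zero_nat (𝕜 := ℝ)).const_mul (q * u ^ 4)).const_add
        (-(var p / 2) * u ^ 2)
      rwa [mul_zero, add_zero] at this
    refine tendsto_of_tendsto_of_tendsto_of_le_of_le' tendsto_const_nhds hup ?_ ?_
    all_goals
      filter_upwards [eventually_gt_atTop 0] with n hn
      have hn' : (0 : ℝ) < n := by exact_mod_cast hn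
      have e2 : (u / √n) ^ 2 = u ^ 2 / n := by rw [div_pow, Real.sq_sqrt hn'.le]
    · have := mul_le_mul_of_nonneg_left (one_sub_le_charFn hp (u / √n)) hn'.le
      rw [e2] at this
      calc -(var p / 2) * u ^ 2 = n * (1 - var p * (u ^ 2 / n) / 2) - n := by field_simp; ring
        _ ≤ n * charFn p (u / √n) - n := by linarith
        _ = _ := by ring
    · have := mul_le_mul_of_nonneg_left (hle (u / √n)) hn'.le
      rw [show (u / √n) ^ 4 = ((u / √n) ^ 2) ^ 2 by ring, e2] at this
      calc (n : ℝ) * (charFn p (u / √n) - 1) = n * charFn p (u / √n) - n := by ring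
        _ ≤ n * (1 - var p * (u ^ 2 / n) / 2 + q * (u ^ 2 / n) ^ 2) - n := by linarith
        _ = _ := by field_simp; ring
  simpa using Real.tendsto_one_add_pow_exp_of_tendsto h

theorem tendsto_sqrt_mul_integral_charFn_pow {p : ℝ} (hp : 2 < p) :
    Tendsto (fun n : ℕ => √n * ∫ t, charFn p t ^ n) atTop (𝓝 (√(2 * Real.pi) / √(var p))) := by
  have hp0 : 0 < p := by linarith
  have hv := var_pos hp0
  have hm := mass_pos hp0
  obtain ⟨c, δ, hc, hδ, hexp⟩ := exists_abs_charFn_le_exp hp0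
  obtain ⟨q, hq0, hq1, hq⟩ := exists_abs_charFn_le_of_le (p := p) (by linarith) hδ
  obtain ⟨B, hB⟩ : ∃ B : ℝ, ∀ k : ℕ, ((k + 2 : ℕ) : ℝ) * q ^ k ≤ B := by
    have h1 := tendsto_self_mul_const_pow_of_lt_one hq0 hq1
    have h2 := (tendsto_pow_atTop_nhds_zero_of_lt_one hq0 hq1).const_mul 2
    obtain ⟨B, hB⟩ := (h1.add h2).bddAbove_range
    refine ⟨B, fun k => le_trans (le_of_eq ?_) (hB ⟨k, rfl⟩)⟩
    push_cast; ring
  have hB0 : 0 ≤ B := le_trans (by positivity) (hB 0)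
  -- Two factors of the power are reserved for the u⁻² decay of the majorant.
  rw [← tendsto_add_atTop_iff_nat 2]
  have hgauss : ∫ u : ℝ, Real.exp (-(var p / 2) * u ^ 2) = √(2 * Real.pi) / √(var p) := by
    rw [integral_gaussian, ← Real.sqrt_div (by positivity)]
    congr 1; field_simp
  rw [← hgauss]
  -- `B` bounds N q^k, where the N comes from rescaling the squared decay bound. The last factor
  -- turns u⁻² into (1 + u²)⁻¹, because |u| ≥ δ in the outer range.
  set D := B * (2 / mass p) ^ 2 * (1 + (δ ^ 2)⁻¹) with hD
  have hlim : Tendsto (fun k : ℕ => ∫ u, charFn p (u / √((k + 2 : ℕ) : ℝ)) ^ (k + 2)) atTop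
      (𝓝 (∫ u : ℝ, Real.exp (-(var p / 2) * u ^ 2))) := by
    refine tendsto_integral_of_dominated_convergence
      (fun u => Real.exp (-c * u ^ 2) + D * (1 + u ^ 2)⁻¹) (fun k => ?_)
      ((integrable_exp_neg_mul_sq hc).add (integrable_inv_one_add_sq.const_mul D))
      (fun k => Eventually.of_forall fun u => ?_) (Eventually.of_forall fun u => ?_)
    · exact (((continuous_charFn hp0).comp (continuous_id.div_const _)).pow _).aestronglyMeasurable
    · have hn : (0 : ℝ) < ((k + 2 : ℕ) : ℝ) := by positivity
      have hn1 : (1 : ℝ) ≤ ((k + 2 : ℕ) : ℝ) := by exact_mod_cast (by omega : 1 ≤ k + 2)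
      have hk := hB k
      generalize hN : ((k + 2 : ℕ) : ℝ) = N at *
      have e2 : (u / √N) ^ 2 = u ^ 2 / N := by rw [div_pow, Real.sq_sqrt hn.le]
      have hD0 : 0 ≤ D * (1 + u ^ 2)⁻¹ := by positivity
      rw [norm_pow, Real.norm_eq_abs]
      rcases le_or_gt |u / √N| δ with h | h
      · have h1 := pow_le_pow_left₀ (abs_nonneg _) (hexp _ h) (k + 2)
        rw [← Real.exp_nat_mul, hN, e2, show N * (-c * (u ^ 2 / N)) = -c * u ^ 2 by
          field_simp] at h1
        linarith
      · have h0 : 0 < |u / √N| := hδ.trans h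
        have hus : δ ^ 2 ≤ u ^ 2 := by
          have h1 : δ ^ 2 ≤ |u / √N| ^ 2 := pow_le_pow_left₀ hδ.le h.le 2
          rw [sq_abs, e2] at h1
          exact h1.trans (div_le_self (sq_nonneg u) hn1)
        have hu0 : 0 < u ^ 2 := lt_of_lt_of_le (by positivity) hus
        have h1 : |charFn p (u / √N)| ≤ 2 / mass p / |u / √N| := by
          rw [le_div_iff₀ h0, mul_comm]
          exact abs_mul_charFn_le (by linarith) _
        have h2 : |charFn p (u / √N)| ^ (k + 2) ≤ D * (1 + u ^ 2)⁻¹ := by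
          calc |charFn p (u / √N)| ^ (k + 2)
              = |charFn p (u / √N)| ^ k * |charFn p (u / √N)| ^ 2 := pow_add _ _ _
            _ ≤ q ^ k * (2 / mass p / |u / √N|) ^ 2 := by
              gcongr
              exact hq _ h.le
            _ = N * q ^ k * (2 / mass p) ^ 2 * (u ^ 2)⁻¹ := by
              rw [div_pow _ |u / √N|, sq_abs, e2]
              field_simp
            _ ≤ B * (2 / mass p) ^ 2 * ((1 + (δ ^ 2)⁻¹) * (1 + u ^ 2)⁻¹) := by
              gcongr
              rw [← div_eq_mul_inv, le_div_iff₀ (by positivity), mul_add, mul_one,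
                inv_mul_cancel₀ hu0.ne']
              have := inv_anti₀ (by positivity) hus
              linarith
            _ = _ := by rw [hD]; ring
        linarith [Real.exp_pos (-c * u ^ 2)]
    · exact (tendsto_charFn_pow hp0 u).comp (tendsto_add_atTop_nat 2)
  refine hlim.congr fun k => ?_
  have := Measure.integral_comp_div (fun t => charFn p t ^ (k + 2)) √((k + 2 : ℕ) : ℝ)
  rw [this, abs_of_nonneg (Real.sqrt_nonneg _), smul_eq_mul]

theorem tendsto_sectionFun_ratio {p : ℝ} (hp : 2 < p) :
    Tendsto (fun n : ℕ => sectionFun n p (diagDir n) / sectionFun n p (pairDir n)) atTop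
      (𝓝 (limitValue p)) := by
  have hp0 : 0 < p := by linarith
  have hv := Real.sqrt_pos.mpr (var_pos hp0)
  have hπ : 0 < √(2 * Real.pi) := Real.sqrt_pos.mpr (by have := Real.pi_pos; positivity)
  have h := ((tendsto_sqrt_mul_integral_charFn_pow hp).const_mul
    (√(var p) / √(2 * Real.pi))).const_mul (limitValue p)
  rw [div_mul_div_cancel₀ hπ.ne', div_self hv.ne', mul_one] at h
  refine h.congr' ?_
  filter_upwards [eventually_ge_atTop 2] with n hn
  obtain ⟨m, rfl⟩ : ∃ m, n = m + 1 := ⟨n - 1, by omega⟩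
  rw [sectionFun_ratio hp (m := m) (by omega), mul_assoc (√(var p) / √(2 * Real.pi))]

/-! ### Concavity of log g² in 1/p -/

/-- The summands of the series for `3 log Γ(1 + x) - log Γ(1 + 3x)`. -/
noncomputable def logTerm (y : ℝ) : ℝ := Real.log (1 + 3 * y) - 3 * Real.log (1 + y)

/-- The function `3 log Γ(1 + x) - log Γ(1 + 3x)`. -/
noncomputable def logGammaDiff (x : ℝ) : ℝ :=
  3 * Real.log (Real.Gamma (1 + x)) - Real.log (Real.Gamma (1 + 3 * x))

theorem log_factorial_eq_sum (n : ℕ) :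
    Real.log (n.factorial : ℝ) = ∑ k ∈ Finset.range n, Real.log ((k : ℝ) + 1) := by
  induction n with
  | zero => simp
  | succ n ih =>
    rw [Finset.sum_range_succ, ← ih, Nat.factorial_succ]
    push_cast
    rw [Real.log_mul (by positivity) (by positivity), add_comm]

/-- In Euler's limit the terms x log n cancel between 3 log Γ(x) and log Γ(3x); the added logarithms
shift the arguments to 1 + x and 1 + 3x. -/
theorem logGammaSeq_combination {x : ℝ} (hx : 0 < x) (n : ℕ) :
    3 * (Real.BohrMollerup.logGammaSeq x n + Real.log x) -
      (Real.BohrMollerup.logGammaSeq (3 * x) n + Real.log (3 * x)) =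
      ∑ k ∈ Finset.range n, logTerm (x / (k + 1)) := by
  have e : ∀ k : ℕ, logTerm (x / (k + 1)) =
      Real.log (3 * x + (k + 1)) - 3 * Real.log (x + (k + 1)) + 2 * Real.log ((k : ℝ) + 1) := by
    intro k
    have hk : (0 : ℝ) < k + 1 := by positivity
    have h1 : 1 + 3 * (x / (k + 1)) = (3 * x + (k + 1)) / (k + 1) := by field_simp; ring
    have h2 : 1 + x / (k + 1) = (x + (k + 1)) / (k + 1) := by field_simp; ring
    rw [logTerm, h1, h2, Real.log_div (by positivity) hk.ne', Real.log_div (by positivity) hk.ne']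
    ring
  simp_rw [e]
  rw [Finset.sum_add_distrib, Finset.sum_sub_distrib, ← Finset.mul_sum, ← Finset.mul_sum,
    ← log_factorial_eq_sum]
  simp only [Real.BohrMollerup.logGammaSeq, Finset.sum_range_succ', Nat.cast_zero, add_zero,
    Nat.cast_add, Nat.cast_one]
  ring

theorem tendsto_sum_logTerm {x : ℝ} (hx : 0 < x) :
    Tendsto (fun n : ℕ => ∑ k ∈ Finset.range n, logTerm (x / (k + 1))) atTop
      (𝓝 (logGammaDiff x)) := by
  have key : ∀ y : ℝ, 0 < y → Tendsto (fun n => Real.BohrMollerup.logGammaSeq y n + Real.log y)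
      atTop (𝓝 (Real.log (Real.Gamma (1 + y)))) := by
    intro y hy
    have h := (Real.BohrMollerup.tendsto_log_gamma hy).add_const (Real.log y)
    rwa [add_comm (Real.log (Real.Gamma y)), ← Real.log_mul hy.ne' (Real.Gamma_pos_of_pos hy).ne',
      ← Real.Gamma_add_one hy.ne', add_comm y] at h
  have h := ((key x hx).const_mul 3).sub (key (3 * x) (by positivity))
  exact h.congr fun n => logGammaSeq_combination hx n

theorem hasDerivAt_logTerm {y : ℝ} (hy : 0 ≤ y) :
    HasDerivAt logTerm (3 / (1 + 3 * y) - 3 / (1 + y)) y := by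
  have h1 : HasDerivAt (fun y : ℝ => 1 + 3 * y) 3 y := by
    simpa using ((hasDerivAt_id y).const_mul 3).const_add 1
  have h2 : HasDerivAt (fun y : ℝ => 1 + y) 1 y := (hasDerivAt_id y).const_add 1
  exact ((h1.log (by positivity)).sub ((h2.log (by positivity)).const_mul 3)).congr_deriv (by ring)

/-- The derivative is -6y/((1+3y)(1+y)), which decreases as long as 3y² < 1; the interval up to 1/2
satisfies this. -/
theorem strictConcaveOn_logTerm : StrictConcaveOn ℝ (Set.Icc 0 (1 / 2)) logTerm := by
  refine StrictAntiOn.strictConcaveOn_of_deriv (convex_Icc _ _)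
    (fun y hy => (hasDerivAt_logTerm hy.1).continuousAt.continuousWithinAt) ?_
  rw [interior_Icc]
  intro y hy z hz hyz
  rw [(hasDerivAt_logTerm hy.1.le).deriv, (hasDerivAt_logTerm hz.1.le).deriv]
  have hy0 := hy.1
  have hz0 := hz.1
  have e : ∀ w : ℝ, 0 < w → 3 / (1 + 3 * w) - 3 / (1 + w) = -(6 * w / ((1 + 3 * w) * (1 + w))) := by
    intro w hw
    field_simp
    ring
  rw [e y hy0, e z hz0, neg_lt_neg_iff, div_lt_div_iff₀ (by positivity) (by positivity)]
  have h1 : y * z < 1 / 2 * (1 / 2) := mul_lt_mul'' hy.2 hz.2 hy0.le hz0.le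
  nlinarith [mul_pos (sub_pos.mpr hyz) (show 0 < 1 - 3 * (y * z) by linarith)]

theorem strictConcaveOn_logGammaDiff : StrictConcaveOn ℝ (Set.Ioc 0 (1 / 2)) logGammaDiff := by
  refine ⟨convex_Ioc _ _, fun x hx y hy hxy a b ha hb hab => ?_⟩
  simp only [smul_eq_mul]
  have hz : a * x + b * y ∈ Set.Ioc (0 : ℝ) (1 / 2) := by
    simpa using convex_Ioc (𝕜 := ℝ) (0 : ℝ) (1 / 2) hx hy ha.le hb.le hab
  have hterm : ∀ k : ℕ, a * logTerm (x / (k + 1)) + b * logTerm (y / (k + 1)) ≤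
      logTerm ((a * x + b * y) / (k + 1)) := by
    intro k
    have hk : (1 : ℝ) ≤ (k : ℝ) + 1 := by linarith [(Nat.cast_nonneg k : (0 : ℝ) ≤ k)]
    have hmem : ∀ w ∈ Set.Ioc (0 : ℝ) (1 / 2), w / ((k : ℝ) + 1) ∈ Set.Icc (0 : ℝ) (1 / 2) :=
      fun w hw => ⟨by have := hw.1; positivity, (div_le_self hw.1.le hk).trans hw.2⟩
    have h := strictConcaveOn_logTerm.concaveOn.2 (hmem x hx) (hmem y hy) ha.le hb.le hab
    simp only [smul_eq_mul] at h
    rwa [← mul_div_assoc, ← mul_div_assoc, ← add_div] at h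
  have hfirst := strictConcaveOn_logTerm.2 (Set.Ioc_subset_Icc_self hx)
    (Set.Ioc_subset_Icc_self hy) hxy ha hb hab
  simp only [smul_eq_mul] at hfirst
  -- A limit of strict inequalities need not be strict, so the positive gap of the summand k = 0 is
  -- carried along as a constant independent of n.
  have hsum : ∀ n : ℕ, a * (∑ k ∈ Finset.range (n + 1), logTerm (x / (k + 1))) +
      b * (∑ k ∈ Finset.range (n + 1), logTerm (y / (k + 1))) +
        (logTerm (a * x + b * y) - (a * logTerm x + b * logTerm y)) ≤
      ∑ k ∈ Finset.range (n + 1), logTerm ((a * x + b * y) / (k + 1)) := by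
    intro n
    simp only [Finset.sum_range_succ' _ n, Nat.cast_zero, zero_add, div_one]
    have : ∑ k ∈ Finset.range n, (a * logTerm (x / ((k + 1 : ℕ) + 1)) +
        b * logTerm (y / ((k + 1 : ℕ) + 1))) ≤
        ∑ k ∈ Finset.range n, logTerm ((a * x + b * y) / ((k + 1 : ℕ) + 1)) :=
      Finset.sum_le_sum fun k _ => hterm (k + 1)
    rw [Finset.sum_add_distrib, ← Finset.mul_sum, ← Finset.mul_sum] at this
    linarith
  have hlim := le_of_tendsto_of_tendsto'
    (((((tendsto_sum_logTerm hx.1).comp (tendsto_add_atTop_nat 1)).const_mul a).add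
      (((tendsto_sum_logTerm hy.1).comp (tendsto_add_atTop_nat 1)).const_mul b)).add_const _)
    ((tendsto_sum_logTerm hz.1).comp (tendsto_add_atTop_nat 1)) hsum
  linarith

/-- `log (limitValue p ^ 2)` as a function of `x = 1 / p`. -/
noncomputable def logLimitSq (x : ℝ) : ℝ :=
  2 * Real.log 2 * x + logGammaDiff x - Real.log (Real.pi / 3)

theorem strictConcaveOn_logLimitSq : StrictConcaveOn ℝ (Set.Ioc 0 (1 / 2)) logLimitSq := by
  refine ⟨convex_Ioc _ _, fun x hx y hy hxy a b ha hb hab => ?_⟩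
  have h := strictConcaveOn_logGammaDiff.2 hx hy hxy ha hb hab
  simp only [smul_eq_mul, logLimitSq] at h ⊢
  have : (a + b) * Real.log (Real.pi / 3) = Real.log (Real.pi / 3) := by rw [hab, one_mul]
  linarith

theorem limitValue_pos {p : ℝ} (hp : 0 < p) : 0 < limitValue p := by
  have h1 := Real.Gamma_pos_of_pos (show 0 < 1 + 1 / p by positivity)
  have h3 := Real.Gamma_pos_of_pos (show 0 < 1 + 3 / p by positivity)
  have hπ := Real.pi_pos
  rw [limitValue]
  positivity

theorem limitValue_sq {p : ℝ} (hp : 0 < p) : limitValue p ^ 2 = Real.exp (logLimitSq (1 / p)) := by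
  have h1 := Real.Gamma_pos_of_pos (show 0 < 1 + 1 / p by positivity)
  have h3 := Real.Gamma_pos_of_pos (show 0 < 1 + 3 / p by positivity)
  have hπ := Real.pi_pos
  rw [limitValue, mul_pow, Real.sq_sqrt (by positivity), Real.sq_sqrt (by positivity),
    ← Real.exp_log (show 0 < 3 / Real.pi * ((2 : ℝ) ^ (2 / p) * Real.Gamma (1 + 1 / p) ^ 3 /
      Real.Gamma (1 + 3 / p)) by positivity)]
  congr 1
  rw [Real.log_mul (by positivity) (by positivity), Real.log_div (by positivity) h3.ne',
    Real.log_mul (by positivity) (by positivity), Real.log_pow, Real.log_rpow (by norm_num),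
    Real.log_div (by norm_num) hπ.ne', logLimitSq, logGammaDiff, Real.log_div hπ.ne' (by norm_num),
    mul_one_div]
  push_cast
  ring_nf

theorem one_lt_limitValue_iff {p : ℝ} (hp : 0 < p) : 1 < limitValue p ↔ 0 < logLimitSq (1 / p) := by
  rw [← one_lt_sq_iff₀ (limitValue_pos hp).le, limitValue_sq hp, Real.one_lt_exp_iff]

theorem limitValue_eq_one_iff {p : ℝ} (hp : 0 < p) :
    limitValue p = 1 ↔ logLimitSq (1 / p) = 0 := by
  rw [← pow_eq_one_iff_of_nonneg (limitValue_pos hp).le two_ne_zero, limitValue_sq hp,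
    Real.exp_eq_one_iff]

/-- The Euclidean case g(2) = 1, which supplies the second endpoint for the concavity arguments. -/
theorem logLimitSq_half : logLimitSq (1 / 2) = 0 := by
  rw [← limitValue_eq_one_iff two_pos]
  have hπ := Real.pi_pos
  have h1 : Real.Gamma (1 + 1 / 2) = √Real.pi / 2 := by
    rw [add_comm, Real.Gamma_add_one (by norm_num), Real.Gamma_one_half_eq]; ring
  have h3 : Real.Gamma (1 + 3 / 2) = 3 * √Real.pi / 4 := by
    rw [show (1 : ℝ) + 3 / 2 = (1 + 1 / 2) + 1 by norm_num, Real.Gamma_add_one (by norm_num), h1]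
    ring
  rw [limitValue, h1, h3, ← Real.sqrt_mul (by positivity)]
  have hs := Real.sq_sqrt hπ.le
  have hs0 := Real.sqrt_pos.mpr hπ
  rw [Real.sqrt_eq_one, div_self two_ne_zero, Real.rpow_one]
  field_simp
  rw [hs]
  ring

theorem continuousOn_logLimitSq : ContinuousOn logLimitSq (Set.Ioi 0) := by
  intro x hx
  have hx' : 0 < x := hx
  have hG : ∀ y : ℝ, 0 < y → ContinuousAt Real.Gamma y := fun y hy =>
    (Real.differentiableAt_Gamma fun m => by
      have : (0 : ℝ) ≤ m := Nat.cast_nonneg m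
      linarith).continuousAt
  have h1 : ContinuousAt (fun x : ℝ => Real.log (Real.Gamma (1 + x))) x :=
    (ContinuousAt.comp (f := fun x : ℝ => 1 + x) (hG _ (by positivity)) (by fun_prop)).log
      (Real.Gamma_pos_of_pos (by positivity)).ne'
  have h3 : ContinuousAt (fun x : ℝ => Real.log (Real.Gamma (1 + 3 * x))) x :=
    (ContinuousAt.comp (f := fun x : ℝ => 1 + 3 * x) (hG _ (by positivity)) (by fun_prop)).log
      (Real.Gamma_pos_of_pos (by positivity)).ne'
  exact (((continuousAt_const.mul continuousAt_id).add
    ((continuousAt_const.mul h1).sub h3)).sub continuousAt_const).continuousWithinAt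

/-! ### Numerical bounds and location of the root -/

/-- The values `∑ 1 / k ^ m`. -/
noncomputable def zetaSum (m : ℕ) : ℝ := ∑' k : ℕ, 1 / ((k : ℝ) + 1) ^ m

theorem tendsto_zetaSum {m : ℕ} (hm : 2 ≤ m) :
    Tendsto (fun n => ∑ k ∈ Finset.range n, 1 / ((k : ℝ) + 1) ^ m) atTop (𝓝 (zetaSum m)) := by
  have h : Summable fun k : ℕ => 1 / ((k : ℝ) + 1) ^ m := by
    have := (summable_nat_add_iff 1).mpr (Real.summable_one_div_nat_pow.mpr (by omega : 1 < m))
    simpa using this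
  exact h.hasSum.tendsto_sum_nat

theorem zetaSum_two : zetaSum 2 = Real.pi ^ 2 / 6 := by
  have h := (hasSum_nat_add_iff' 1).mpr hasSum_zeta_two
  simp at h
  simpa [zetaSum] using h.tsum_eq

theorem zetaSum_four : zetaSum 4 = Real.pi ^ 4 / 90 := by
  have h := (hasSum_nat_add_iff' 1).mpr hasSum_zeta_four
  simp at h
  simpa [zetaSum] using h.tsum_eq

theorem sum_le_zetaSum {m : ℕ} (hm : 2 ≤ m) (N : ℕ) :
    ∑ k ∈ Finset.range N, 1 / ((k : ℝ) + 1) ^ m ≤ zetaSum m :=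
  Monotone.ge_of_tendsto (monotone_nat_of_le_succ fun n => by
    rw [Finset.sum_range_succ]
    have : (0 : ℝ) ≤ 1 / ((n : ℝ) + 1) ^ m := by positivity
    linarith) (tendsto_zetaSum hm) N

theorem zetaSum_le {m N : ℕ} (hm : 2 ≤ m) (hN : 0 < N) :
    zetaSum m ≤ ∑ k ∈ Finset.range N, 1 / ((k : ℝ) + 1) ^ m + 1 / (N : ℝ) ^ (m - 1) := by
  have hN' : (0 : ℝ) < N := by exact_mod_cast hN
  obtain ⟨j, rfl⟩ : ∃ j, m = j + 2 := ⟨m - 2, by omega⟩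
  rw [show j + 2 - 1 = j + 1 by omega]
  -- The extra summand is the remainder of the telescoping comparison 1/(n+1)² ≤ 1/n - 1/(n+1);
  -- carrying it makes the induction close.
  have key : ∀ n, N ≤ n → ∑ k ∈ Finset.range n, 1 / ((k : ℝ) + 1) ^ (j + 2) +
      1 / (N : ℝ) ^ j * (1 / n) ≤
      ∑ k ∈ Finset.range N, 1 / ((k : ℝ) + 1) ^ (j + 2) + 1 / (N : ℝ) ^ (j + 1) := by
    intro n hn
    induction n, hn using Nat.le_induction with
    | base => exact le_of_eq (by rw [one_div_mul_one_div, ← pow_succ])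
    | succ n hn ih =>
      refine le_trans ?_ ih
      have hn' : (N : ℝ) ≤ n := by exact_mod_cast hn
      have hn0 : (0 : ℝ) < n := hN'.trans_le hn'
      rw [Finset.sum_range_succ, add_assoc]
      refine add_le_add_right ?_ _
      push_cast
      have h1 : 1 / ((n : ℝ) + 1) ^ j ≤ 1 / (N : ℝ) ^ j :=
        one_div_le_one_div_of_le (by positivity) (pow_le_pow_left₀ hN'.le (by linarith) j)
      have h2 : 1 / ((n : ℝ) + 1) ^ 2 ≤ 1 / n - 1 / (n + 1) := by
        rw [div_sub_div _ _ hn0.ne' (by positivity), div_le_div_iff₀ (by positivity) (by positivity)]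
        nlinarith
      have h3 : 1 / ((n : ℝ) + 1) ^ (j + 2) ≤ 1 / (N : ℝ) ^ j * (1 / n - 1 / (n + 1)) := by
        rw [pow_add, ← one_div_mul_one_div]
        exact mul_le_mul h1 h2 (by positivity) (by positivity)
      linarith
  refine le_of_tendsto (tendsto_zetaSum hm) ?_
  filter_upwards [eventually_ge_atTop N] with n hn
  have := key n hn
  have : 0 ≤ 1 / (N : ℝ) ^ j * (1 / n) := by positivity
  linarith

/-- These are Taylor polynomials with coefficients (-1)^(m+1) (3^m - 3)/m. Since the series
alternates, consecutive truncations enclose the function; the derivative of each remainder has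
constant sign on y ≥ 0. -/
theorem logTerm_bounds {y : ℝ} (hy : 0 ≤ y) :
    -3 * y ^ 2 + 8 * y ^ 3 - 39 / 2 * y ^ 4 + 48 * y ^ 5 - 121 * y ^ 6 ≤ logTerm y ∧
    logTerm y ≤ -3 * y ^ 2 + 8 * y ^ 3 - 39 / 2 * y ^ 4 + 48 * y ^ 5 - 121 * y ^ 6 +
      312 * y ^ 7 := by
  have hz : logTerm 0 = 0 := by simp [logTerm]
  have hpoly : ∀ c y : ℝ, HasDerivAt (fun y : ℝ => -3 * y ^ 2 + 8 * y ^ 3 - 39 / 2 * y ^ 4 +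
      48 * y ^ 5 - 121 * y ^ 6 + c * y ^ 7)
      (-6 * y + 24 * y ^ 2 - 78 * y ^ 3 + 240 * y ^ 4 - 726 * y ^ 5 + 7 * c * y ^ 6) y := by
    intro c y
    have h := ((((((hasDerivAt_pow 2 y).const_mul (-3)).add ((hasDerivAt_pow 3 y).const_mul 8)).sub
      ((hasDerivAt_pow 4 y).const_mul (39 / 2))).add ((hasDerivAt_pow 5 y).const_mul 48)).sub
      ((hasDerivAt_pow 6 y).const_mul 121)).add ((hasDerivAt_pow 7 y).const_mul c)
    refine h.congr_deriv ?_
    norm_num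
    ring
  have hmono : MonotoneOn (fun y : ℝ => logTerm y - (-3 * y ^ 2 + 8 * y ^ 3 -
      39 / 2 * y ^ 4 + 48 * y ^ 5 - 121 * y ^ 6 + 0 * y ^ 7)) (Set.Ici 0) := by
    refine monotoneOn_of_hasDerivWithinAt_nonneg (convex_Ici 0)
      (fun y hy => ((hasDerivAt_logTerm hy).sub (hpoly 0 y)).continuousAt.continuousWithinAt)
      (fun y hy => ((hasDerivAt_logTerm (interior_subset hy)).sub
        (hpoly 0 y)).hasDerivWithinAt) fun y hy => ?_
    rw [interior_Ici] at hy
    have hy0 : 0 < y := hy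
    rw [show 3 / (1 + 3 * y) - 3 / (1 + y) - (-6 * y + 24 * y ^ 2 - 78 * y ^ 3 + 240 * y ^ 4 -
      726 * y ^ 5 + 7 * 0 * y ^ 6) = y ^ 6 * (2184 + 2178 * y) / ((1 + 3 * y) * (1 + y)) by
      field_simp; ring]
    positivity
  have hanti : AntitoneOn (fun y : ℝ => logTerm y - (-3 * y ^ 2 + 8 * y ^ 3 -
      39 / 2 * y ^ 4 + 48 * y ^ 5 - 121 * y ^ 6 + 312 * y ^ 7)) (Set.Ici 0) := by
    refine antitoneOn_of_hasDerivWithinAt_nonpos (convex_Ici 0)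
      (fun y hy => ((hasDerivAt_logTerm hy).sub (hpoly 312 y)).continuousAt.continuousWithinAt)
      (fun y hy => ((hasDerivAt_logTerm (interior_subset hy)).sub
        (hpoly 312 y)).hasDerivWithinAt) fun y hy => ?_
    rw [interior_Ici] at hy
    have hy0 : 0 < y := hy
    rw [show 3 / (1 + 3 * y) - 3 / (1 + y) - (-6 * y + 24 * y ^ 2 - 78 * y ^ 3 + 240 * y ^ 4 -
      726 * y ^ 5 + 7 * 312 * y ^ 6) = -(y ^ 7 * (6558 + 6552 * y) / ((1 + 3 * y) * (1 + y))) by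
      field_simp; ring]
    have : 0 ≤ y ^ 7 * (6558 + 6552 * y) / ((1 + 3 * y) * (1 + y)) := by positivity
    linarith
  constructor
  · have h := hmono Set.self_mem_Ici hy hy
    simp only [hz] at h
    linarith
  · have h := hanti Set.self_mem_Ici hy hy
    simp only [hz] at h
    linarith

theorem logGammaDiff_bounds {x : ℝ} (hx : 0 < x) :
    -3 * zetaSum 2 * x ^ 2 + 8 * zetaSum 3 * x ^ 3 - 39 / 2 * zetaSum 4 * x ^ 4 +
      48 * zetaSum 5 * x ^ 5 - 121 * zetaSum 6 * x ^ 6 ≤ logGammaDiff x ∧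
    logGammaDiff x ≤ -3 * zetaSum 2 * x ^ 2 + 8 * zetaSum 3 * x ^ 3 -
      39 / 2 * zetaSum 4 * x ^ 4 + 48 * zetaSum 5 * x ^ 5 - 121 * zetaSum 6 * x ^ 6 +
      312 * zetaSum 7 * x ^ 7 := by
  have t : ∀ c : ℝ, ∀ m : ℕ, 2 ≤ m → Tendsto (fun n => ∑ k ∈ Finset.range n,
      c * (x / ((k : ℝ) + 1)) ^ m) atTop (𝓝 (c * zetaSum m * x ^ m)) := by
    intro c m hm
    have h := (tendsto_zetaSum hm).const_mul (c * x ^ m)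
    rw [show c * x ^ m * zetaSum m = c * zetaSum m * x ^ m by ring] at h
    refine h.congr fun n => ?_
    rw [Finset.mul_sum]
    refine Finset.sum_congr rfl fun k _ => ?_
    rw [div_pow]; ring
  have t6 := ((((t (-3) 2 le_rfl).add (t 8 3 (by norm_num))).sub (t (39 / 2) 4 (by norm_num))).add
    (t 48 5 (by norm_num))).sub (t 121 6 (by norm_num))
  have t7 := t6.add (t 312 7 (by norm_num))
  constructor
  · refine le_of_tendsto_of_tendsto' t6 (tendsto_sum_logTerm hx) fun n => ?_
    rw [← Finset.sum_add_distrib, ← Finset.sum_sub_distrib, ← Finset.sum_add_distrib,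
      ← Finset.sum_sub_distrib]
    exact Finset.sum_le_sum fun k _ => (logTerm_bounds (by positivity)).1
  · refine le_of_tendsto_of_tendsto' (tendsto_sum_logTerm hx) t7 fun n => ?_
    rw [← Finset.sum_add_distrib, ← Finset.sum_sub_distrib, ← Finset.sum_add_distrib,
      ← Finset.sum_sub_distrib, ← Finset.sum_add_distrib]
    exact Finset.sum_le_sum fun k _ => (logTerm_bounds (by positivity)).2

theorem log_pi_div_three_bounds :
    0.046117595 < Real.log (Real.pi / 3) ∧ Real.log (Real.pi / 3) < 0.0461176 := by
  have hπ := Real.pi_pos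
  have h1 := Real.pi_gt_d20
  have h2 := Real.pi_lt_d20
  have key : ∀ z : ℝ, 0 ≤ z → z < 1 →
      |(∑ i ∈ Finset.range 6, z ^ (i + 1) / (i + 1)) + Real.log (1 - z)| ≤ z ^ 7 / (1 - z) := by
    intro z hz0 hz1
    have h := Real.abs_log_sub_add_sum_range_le (x := z) (by rwa [abs_of_nonneg hz0]) 6
    rwa [abs_of_nonneg hz0] at h
  constructor
  -- log(π/3) = -log(1 - z) with z = 1 - 3/π; this decimal and the one in the upper bound enclose z.
  · have h := (abs_le.mp (key 0.04507034144 (by norm_num) (by norm_num))).2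
    have hlog : -Real.log (1 - 0.04507034144) ≤ Real.log (Real.pi / 3) := by
      rw [← Real.log_inv]
      refine Real.log_le_log (by norm_num) ?_
      rw [le_div_iff₀ (by norm_num)]
      refine le_trans ?_ h1.le
      norm_num
    norm_num [Finset.sum_range_succ] at h hlog ⊢
    linarith
  · have h := (abs_le.mp (key 0.04507034145 (by norm_num) (by norm_num))).1
    have hlog : Real.log (Real.pi / 3) ≤ -Real.log (1 - 0.04507034145) := by
      rw [← Real.log_inv]
      refine Real.log_le_log (by positivity) ?_
      rw [div_le_iff₀ (by norm_num)]
      refine h2.le.trans ?_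
      norm_num
    norm_num [Finset.sum_range_succ] at h hlog ⊢
    linarith

theorem zetaSum_three_bounds : 1.2018 ≤ zetaSum 3 ∧ zetaSum 3 ≤ 1.2023 := by
  constructor
  · refine le_trans ?_ (sum_le_zetaSum (by norm_num) 50)
    norm_num [Finset.sum_range_succ]
  · refine (zetaSum_le (by norm_num) (N := 50) (by norm_num)).trans ?_
    norm_num [Finset.sum_range_succ]

theorem zetaSum_five_bounds : 1.0366 ≤ zetaSum 5 ∧ zetaSum 5 ≤ 1.0383 := by
  constructor
  · refine le_trans ?_ (sum_le_zetaSum (by norm_num) 5)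
    norm_num [Finset.sum_range_succ]
  · refine (zetaSum_le (by norm_num) (N := 5) (by norm_num)).trans ?_
    norm_num [Finset.sum_range_succ]

theorem zetaSum_six_bounds : 1.0172 ≤ zetaSum 6 ∧ zetaSum 6 ≤ 1.0177 := by
  constructor
  · refine le_trans ?_ (sum_le_zetaSum (by norm_num) 5)
    norm_num [Finset.sum_range_succ]
  · refine (zetaSum_le (by norm_num) (N := 5) (by norm_num)).trans ?_
    norm_num [Finset.sum_range_succ]

theorem zetaSum_seven_le : zetaSum 7 ≤ 1.009 := by
  refine (zetaSum_le (by norm_num) (N := 5) (by norm_num)).trans ?_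
  norm_num [Finset.sum_range_succ]

theorem pi_sq_bounds : 9.8696044 ≤ Real.pi ^ 2 ∧ Real.pi ^ 2 ≤ 9.8696045 := by
  have h1 := Real.pi_gt_d20
  have h2 := Real.pi_lt_d20
  constructor <;> nlinarith

theorem pi_pow_four_bounds : 97.40909 ≤ Real.pi ^ 4 ∧ Real.pi ^ 4 ≤ 97.4091 := by
  obtain ⟨h1, h2⟩ := pi_sq_bounds
  rw [show Real.pi ^ 4 = (Real.pi ^ 2) ^ 2 by ring]
  constructor <;> nlinarith

theorem le_logLimitSq {x : ℝ} (hx : 0 < x) :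
    1.3862943606 * x - 4.93480225 * x ^ 2 + 9.6144 * x ^ 3 - 21.105305 * x ^ 4 + 49.7568 * x ^ 5 -
      123.1417 * x ^ 6 - 0.0461176 ≤ logLimitSq x := by
  have h := (logGammaDiff_bounds hx).1
  rw [zetaSum_two, zetaSum_four] at h
  have a2 := mul_le_mul_of_nonneg_right pi_sq_bounds.2 (pow_pos hx 2).le
  have a3 := mul_le_mul_of_nonneg_right zetaSum_three_bounds.1 (pow_pos hx 3).le
  have a4 := mul_le_mul_of_nonneg_right pi_pow_four_bounds.2 (pow_pos hx 4).le
  have a5 := mul_le_mul_of_nonneg_right zetaSum_five_bounds.1 (pow_pos hx 5).le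
  have a6 := mul_le_mul_of_nonneg_right zetaSum_six_bounds.2 (pow_pos hx 6).le
  have a1 := mul_le_mul_of_nonneg_right Real.log_two_gt_d9.le hx.le
  have a0 := log_pi_div_three_bounds.2
  rw [logLimitSq]
  linarith [pow_pos hx 4]

theorem logLimitSq_le {x : ℝ} (hx : 0 < x) :
    logLimitSq x ≤ 1.3862943617 * x - 4.9348022 * x ^ 2 + 9.6184 * x ^ 3 - 21.1053 * x ^ 4 +
      49.8384 * x ^ 5 - 123.0812 * x ^ 6 + 314.808 * x ^ 7 - 0.046117595 := by
  have h := (logGammaDiff_bounds hx).2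
  rw [zetaSum_two, zetaSum_four] at h
  have a2 := mul_le_mul_of_nonneg_right pi_sq_bounds.1 (pow_pos hx 2).le
  have a3 := mul_le_mul_of_nonneg_right zetaSum_three_bounds.2 (pow_pos hx 3).le
  have a4 := mul_le_mul_of_nonneg_right pi_pow_four_bounds.1 (pow_pos hx 4).le
  have a5 := mul_le_mul_of_nonneg_right zetaSum_five_bounds.2 (pow_pos hx 5).le
  have a6 := mul_le_mul_of_nonneg_right zetaSum_six_bounds.1 (pow_pos hx 6).le
  have a7 := mul_le_mul_of_nonneg_right zetaSum_seven_le (pow_pos hx 7).le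
  have a1 := mul_le_mul_of_nonneg_right Real.log_two_lt_d9.le hx.le
  have a0 := log_pi_div_three_bounds.1
  rw [logLimitSq]
  linarith [pow_pos hx 4]

/-- Half a unit of 0.001 in p near 26.265 is only about 7e-7 in 1/p, which dictates the precision of
the preceding constants. -/
theorem exists_logLimitSq_root :
    ∃ p₀ : ℝ, 26.2645 < p₀ ∧ p₀ < 26.2655 ∧ logLimitSq (1 / p₀) = 0 := by
  have h1 : 0 < logLimitSq (1 / 26.2645) :=
    lt_of_lt_of_le (by norm_num) (le_logLimitSq (by norm_num))
  have h2 : logLimitSq (1 / 26.2655) < 0 :=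
    lt_of_le_of_lt (logLimitSq_le (by norm_num)) (by norm_num)
  have hle : (1 / 26.2655 : ℝ) ≤ 1 / 26.2645 := by norm_num
  obtain ⟨x, hx, hx0⟩ := intermediate_value_Ioo hle
    (continuousOn_logLimitSq.mono fun y hy => lt_of_lt_of_le (by norm_num) hy.1) ⟨h2, h1⟩
  have hxpos : 0 < x := lt_trans (by norm_num) hx.1
  refine ⟨1 / x, ?_, ?_, by rwa [one_div_one_div]⟩
  · rw [lt_div_iff₀ hxpos]
    have := hx.2
    rw [lt_div_iff₀ (by norm_num)] at this
    linarith
  · rw [div_lt_iff₀ hxpos]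
    have := hx.1
    rw [div_lt_iff₀ (by norm_num)] at this
    linarith

/-! ### Chord estimates and the quantitative comparison -/

/-- The chord inequality for `logLimitSq`. -/
theorem logLimitSq_chord {x y z : ℝ} (hx : 0 < x) (hxy : x < y) (hyz : y < z) (hz : z ≤ 1 / 2) :
    (z - y) * logLimitSq x + (y - x) * logLimitSq z < (z - x) * logLimitSq y := by
  have hzx : 0 < z - x := by linarith
  have h := strictConcaveOn_logLimitSq.2 (x := x) (y := z) ⟨hx, by linarith⟩ ⟨by linarith, hz⟩
    (by linarith) (div_pos (sub_pos.mpr hyz) hzx) (div_pos (sub_pos.mpr hxy) hzx)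
    (by field_simp; ring)
  have e : (z - y) / (z - x) * x + (y - x) / (z - x) * z = y := by field_simp; ring
  simp only [smul_eq_mul, e] at h
  calc (z - y) * logLimitSq x + (y - x) * logLimitSq z
      = (z - x) * ((z - y) / (z - x) * logLimitSq x + (y - x) / (z - x) * logLimitSq z) := by
        field_simp
    _ < _ := mul_lt_mul_of_pos_left h hzx

theorem logLimitSq_pos {p p₀ : ℝ} (hp : 2 < p) (hpp : p < p₀) (h0 : logLimitSq (1 / p₀) = 0) :
    0 < logLimitSq (1 / p) := by
  have h1 : 1 / p₀ < 1 / p := one_div_lt_one_div_of_lt (by linarith) hpp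
  have h2 : 1 / p < 1 / 2 := one_div_lt_one_div_of_lt (by norm_num) hp
  have h := logLimitSq_chord (by have : 0 < p₀ := by linarith
                                 positivity) h1 h2 le_rfl
  rw [h0, logLimitSq_half, mul_zero, mul_zero, add_zero] at h
  exact pos_of_mul_pos_right h (by linarith)

theorem logLimitSq_neg {p p₀ : ℝ} (hp : 2 < p₀) (hpp : p₀ < p) (h0 : logLimitSq (1 / p₀) = 0) :
    logLimitSq (1 / p) < 0 := by
  have h1 : 1 / p < 1 / p₀ := one_div_lt_one_div_of_lt (by linarith) hpp
  have h2 : 1 / p₀ < 1 / 2 := one_div_lt_one_div_of_lt (by norm_num) hp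
  have h := logLimitSq_chord (by have : 0 < p := by linarith
                                 positivity) h1 h2 le_rfl
  rw [h0, logLimitSq_half, mul_zero, mul_zero, add_zero] at h
  by_contra hc
  push Not at hc
  have := mul_nonneg (sub_pos.mpr h2).le hc
  linarith

/-- With L = `logLimitSq`, the chord from the root 1/p₀ to 1/q gives L(1/p) ≥ L(1/q) · (p₀ - p) / (p
(p₀/q - 1)). Bounding p by `b` and p₀ by 26.2655 leaves the numerical condition `hb`. -/
theorem logLimitSq_ge_of_chord {p p₀ q b v : ℝ} (hq : 2 < q) (hqp : q ≤ p) (hpp : p < p₀)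
    (hpb : p ≤ b) (h0 : logLimitSq (1 / p₀) = 0) (hv : v ≤ logLimitSq (1 / q))
    (hp₀ : p₀ < 26.2655) (hb : 0.9 / 650 * b * (26.2655 / q - 1) ≤ v) :
    0.9 / 650 * (p₀ - p) ≤ logLimitSq (1 / p) := by
  have hq0 : 0 < q := by linarith
  have hp0 : 0 < p := by linarith
  have hp00 : 0 < p₀ := by linarith
  have hb0 : 0 < b := by linarith
  have hv' : 0.9 / 650 * p * (p₀ / q - 1) ≤ logLimitSq (1 / q) := by
    refine le_trans (le_trans ?_ hb) hv
    have h1 : p₀ / q - 1 ≤ 26.2655 / q - 1 :=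
      sub_le_sub_right (div_le_div_of_nonneg_right hp₀.le hq0.le) _
    have h2 : 0 ≤ p₀ / q - 1 := by
      rw [sub_nonneg, one_le_div hq0]; linarith
    gcongr
  rcases eq_or_lt_of_le hqp with rfl | hlt
  · refine le_trans (le_of_eq ?_) hv'
    field_simp
  · have h := logLimitSq_chord (x := 1 / p₀) (y := 1 / p) (z := 1 / q) (by positivity)
      (one_div_lt_one_div_of_lt hp0 hpp) (one_div_lt_one_div_of_lt hq0 hlt)
      (one_div_le_one_div_of_le (by norm_num) hq.le)
    rw [h0, mul_zero, zero_add] at h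
    have h1 : 0 < 1 / q - 1 / p₀ := sub_pos.mpr (one_div_lt_one_div_of_lt hq0 (by linarith))
    have h2 : 0 ≤ 1 / p - 1 / p₀ := (sub_pos.mpr (one_div_lt_one_div_of_lt hp0 hpp)).le
    refine le_of_mul_le_mul_left (le_trans (le_of_eq ?_) ((mul_le_mul_of_nonneg_left hv' h2).trans
      h.le)) h1
    field_simp

theorem logLimitSq_fifth : (0.0849 : ℝ) ≤ logLimitSq (1 / 5) :=
  le_trans (by norm_num) (le_logLimitSq (by norm_num))

theorem logLimitSq_ge_of_five_le {p p₀ : ℝ} (hp : 5 ≤ p) (hpp : p < p₀)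
    (h0 : logLimitSq (1 / p₀) = 0) (hp₀ : p₀ < 26.2655) :
    0.9 / 650 * (p₀ - p) ≤ logLimitSq (1 / p) := by
  -- With the available value at 1/5, the criterion fails for p up to p₀, so the chord is restarted
  -- at q = 13 and q = 24.
  rcases le_total p 13 with h | h
  · exact logLimitSq_ge_of_chord (by norm_num) hp hpp h h0 logLimitSq_fifth hp₀ (by norm_num)
  rcases le_total p 24 with h' | h'
  · have hv : (0.035 : ℝ) ≤ logLimitSq (1 / 13) :=
      le_trans (by norm_num) (le_logLimitSq (by norm_num))
    exact logLimitSq_ge_of_chord (by norm_num) h hpp h' h0 hv hp₀ (by norm_num)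
  · have hv : (0.0037 : ℝ) ≤ logLimitSq (1 / 24) :=
      le_trans (by norm_num) (le_logLimitSq (by norm_num))
    exact logLimitSq_ge_of_chord (b := 26.2655) (by norm_num) h' hpp (by linarith) h0 hv hp₀
      (by norm_num)

/-- Uses the chord between x = 1/5 and the zero at x = 1/2. -/
theorem logLimitSq_ge_of_lt_five {p : ℝ} (hp : 2 < p) (hp5 : p < 5) :
    0.9 / 65 * (p - 2) ≤ logLimitSq (1 / p) := by
  have hp0 : 0 < p := by linarith
  have h := logLimitSq_chord (x := 1 / 5) (y := 1 / p) (z := 1 / 2) (by norm_num)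
    (one_div_lt_one_div_of_lt hp0 hp5) (one_div_lt_one_div_of_lt (by norm_num) hp) le_rfl
  rw [logLimitSq_half, mul_zero, add_zero] at h
  have h1 : 1 / 2 - 1 / p = (p - 2) / (2 * p) := by field_simp
  have h2 : (p - 2) / 10 ≤ 1 / 2 - 1 / p := by
    rw [h1]
    exact div_le_div_of_nonneg_left (by linarith) (by linarith) (by linarith)
  have h3 := mul_le_mul h2 logLimitSq_fifth (by norm_num) (by linarith)
  linarith

theorem sectionFun_pairDir_lt_diagDir {p : ℝ} {n : ℕ} (hp : 2 < p) (hn : 20 ≤ n)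
    (h : 0.9 / (n : ℝ) ≤ logLimitSq (1 / p)) :
    sectionFun n p (pairDir n) < sectionFun n p (diagDir n) := by
  obtain ⟨k, rfl⟩ : ∃ k, n = k + 2 := ⟨n - 2, by omega⟩
  have hp0 : 0 < p := by linarith
  have hn' : (0 : ℝ) < ((k + 2 : ℕ) : ℝ) := by positivity
  have hg1 : 1 < limitValue p :=
    (one_lt_limitValue_iff hp0).mpr (lt_of_lt_of_le (by positivity) h)
  have hsq : 1 + 0.9 / ((k + 2 : ℕ) : ℝ) ≤ limitValue p ^ 2 := by
    rw [limitValue_sq hp0]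
    linarith [Real.add_one_le_exp (logLimitSq (1 / p))]
  have h1 := one_lt_mul_betaHalf (by omega) (limitValue_pos hp0).le hsq
  have h2 := h1.trans_le (sectionFun_ratio_ge hp hg1.le k)
  have h3 : 0 < sectionFun (k + 2) p (pairDir (k + 2)) := by
    rw [sectionFun_pairDir hp (m := k + 1) (by omega)]
    positivity
  rwa [one_lt_div h3] at h2

end LpSection

theorem theorem1 :
    ∃ p₀ : ℝ,
      -- `p₀` is the only solution in `(2, ∞)` of `limitValue p = 1`, and `p₀ ≈ 26.265`
      (∀ p : ℝ, 2 < p → (LpSection.limitValue p = 1 ↔ p = p₀)) ∧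
      |p₀ - 26.265| ≤ 0.0005 ∧
      -- the limit of the ratio, and its comparison with `1`
      (∀ p : ℝ, 2 < p → p < p₀ →
        Tendsto (fun n : ℕ =>
            LpSection.sectionFun n p (LpSection.diagDir n) /
              LpSection.sectionFun n p (LpSection.pairDir n))
          atTop (𝓝 (LpSection.limitValue p)) ∧
        1 < LpSection.limitValue p) ∧
      -- the quantitative estimate
      (∀ (p : ℝ) (n : ℕ),
        (5 ≤ p ∧ p < p₀ ∧ 650 / (p₀ - p) ≤ (n : ℝ)) ∨
          (2 < p ∧ p < 5 ∧ 65 / (p - 2) < (n : ℝ)) →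
        LpSection.sectionFun n p (LpSection.pairDir n) <
          LpSection.sectionFun n p (LpSection.diagDir n)) := by
  obtain ⟨p₀, hlo, hhi, h0⟩ := LpSection.exists_logLimitSq_root
  refine ⟨p₀, fun p hp => ?_, ?_, fun p hp hpp => ⟨LpSection.tendsto_sectionFun_ratio hp, ?_⟩,
    fun p n h => ?_⟩
  · rw [LpSection.limitValue_eq_one_iff (by linarith)]
    constructor
    · intro h
      rcases lt_trichotomy p p₀ with hlt | heq | hgt
      · exact absurd h (LpSection.logLimitSq_pos hp hlt h0).ne'
      · exact heq
      · exact absurd h (LpSection.logLimitSq_neg (by linarith) hgt h0).ne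
    · rintro rfl
      exact h0
  · rw [abs_le]
    constructor <;> linarith
  · exact (LpSection.one_lt_limitValue_iff (by linarith)).mpr (LpSection.logLimitSq_pos hp hpp h0)
  · rcases h with ⟨hp, hpp, hn⟩ | ⟨hp, hp5, hn⟩
    · have hd : 0 < p₀ - p := by linarith
      rw [div_le_iff₀ hd] at hn
      have hn0 : (0 : ℝ) < n := by
        by_contra hc
        push Not at hc
        nlinarith
      -- Since p ≥ 5 gives p₀ - p ≤ 22, the assumption on n already implies n ≥ 650/22 > 20; in case
      -- (b) the analogous bound is 65/3 > 20.
      have hn20 : (20 : ℝ) ≤ n := by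
        have : (n : ℝ) * (p₀ - p) ≤ n * 22 := mul_le_mul_of_nonneg_left (by linarith) hn0.le
        linarith
      refine LpSection.sectionFun_pairDir_lt_diagDir (by linarith) (by exact_mod_cast hn20)
        (le_trans ?_ (LpSection.logLimitSq_ge_of_five_le hp hpp h0 hhi))
      rw [div_le_iff₀ hn0]
      linarith
    · have hd : 0 < p - 2 := by linarith
      rw [div_lt_iff₀ hd] at hn
      have hn0 : (0 : ℝ) < n := by
        by_contra hc
        push Not at hc
        nlinarith
      have hn20 : (20 : ℝ) ≤ n := by
        have : (n : ℝ) * (p - 2) ≤ n * 3 := mul_le_mul_of_nonneg_left (by linarith) hn0.le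
        linarith
      refine LpSection.sectionFun_pairDir_lt_diagDir hp (by exact_mod_cast hn20)
        (le_trans ?_ (LpSection.logLimitSq_ge_of_lt_five hp hp5))
      rw [div_le_iff₀ hn0]
      linarith
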